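/- **Setting.** Let $\alpha\in(1,2]$ and let $L$ be a real-valued, not identically zero, symmetric $\alpha$-stable Lévy process on a probability space $(\Omega,\mathbb P)$: it has $L_0=0$, càdlàg paths, independent stationary increments, $t^{-1/\alpha}L_t\overset{d}{=}L_1$ for $t>0$, and $L\overset{d}{=}-L$; for $\alpha=2$ it is a Brownian motion. Let $N\in\mathbb N$ be the horizon, $r\in\mathbb R$, $M>0$, let $\mu,\sigma:[0,N]\to\mathbb R$ be continuous with $\sigma>0$ and $\mu_t\ge r$ for all $t\in[0,N]$, and let $\lambda:[0,N]\to(0,\infty)$ be continuous. A (discrete-time) control law $u=(u_k)_{0\le k<N}$ consists of measurable functions $u_k:\mathbb R\to[-M,M]$; $u_k(y)$ is the amount invested in the risky asset during $(k,k+1]$ if the wealth at time $k$ is $y$. It is deterministic if every $u_k$ is constant. For $n<N$ and $x\in\mathbb R$, the wealth process $X=X^{n,x,u}$ is the càdlàg solution on $[n,N]$ of $$dX_t=\bigl(rX_t+u_t(\mu_t-r)\bigr)\,dt+u_t\,\sigma_t\,dL_t,\qquad X_n=x,\qquad u_t=u_k(X_k)\ \text{ for } t\in(k,k+1].$$ Let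 $\mathcal T\in C^1(\mathbb R)$ be non-decreasing and concave with $\mathbb E|\mathcal T(a+bL_t)|<\infty$ and $\mathbb E|\mathcal T'(a+bL_t)|<\infty$ for all $a,b\in\mathbb R$ and $t\in(0,N]$. Let $F:\mathbb R\to\mathbb R$ be non-decreasing, convex and differentiable with $F'(0)=0$; put $F(+\infty):=\sup F$. Let $\rho$ be a risk measure: a map from random variables to $\mathbb R\cup\{+\infty\}$ that is law-invariant and positively homogeneous ($\rho(\beta Y)=\beta\rho(Y)$ for $\beta\ge0$, with $0\cdot\infty=0$), and either cash-invariant ($\rho(Y+m)=\rho(Y)-m$ for $m\in\mathbb R$) or shift-invariant ($\rho(Y+m)=\rho(Y)$ for $m\in\mathbb R$). Assume $\rho(L_1)<\infty$. Define $$J_n(x,u)=\mathbb E\bigl[\mathcal T\bigl(X_N^{n,x,u}-xe^{r(N-n)}\bigr)\bigr]-\lambda_n\,F\bigl(\rho\bigl(X_N^{n,x,u}-xe^{r(N-n)}\bigr)\bigr).$$ A control law $\hat u$ is *optimal* if it is a perfect subgame Nash equilibrium: for all $n<N$ and $x\in\mathbb R$, $\ \sup_{v\in[-M,M]}J_n(x,\bar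 u^{v})=J_n(x,\hat u)$, where $\bar u^{v}_n\equiv v$ and $\bar u^{v}_k=\hat u_k$ for $k\neq n$. **Proposition.** 1. Suppose that for each $n\in\{0,\dots,N-1\}$ at least one of the following holds: (i) $\mathcal T$ is not affine; (ii) $\mathcal T$ is not constant and $\mu_s>r$ for some $s\in[n,n+1]$; (iii) $\rho(L_1)>0$, $F(y)>F(0)$ for all $y>0$, and either $\rho$ is shift-invariant or $\mu_s=r$ for all $s\in[n,N]$. Then every optimal deterministic control $\hat u$ is non-negative: $\hat u_n\ge 0$ for all $n<N$. 2. If $\mathcal T$ is strictly concave, then every optimal control law $\hat u$, deterministic or not, is non-negative: $\hat u_n(y)\ge0$ for all $n<N$ and $y\in\mathbb R$. -/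

import Mathlib

open MeasureTheory ProbabilityTheory Filter Set Topology
open scoped NNReal

noncomputable section

/-- A path `f` is càdlàg on `[a, b]`. -/
def IsCadlagOn (f : ℝ → ℝ) (a b : ℝ) : Prop :=
  (∀ t ∈ Ico a b, ContinuousWithinAt f (Ici t) t) ∧
    ∀ t ∈ Ioc a b, ∃ l : ℝ, Tendsto f (𝓝[<] t) (𝓝 l)

/-- `L` is a real, symmetric, `α`-stable Lévy process (not identically zero): it starts at `0`, has
càdlàg paths and independent stationary increments, and `t ^ (-1/α) L_t` has the law of `L_1` for
every `t > 0`; for `α = 2` it is normalised to be a Brownian motion. -/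
structure IsSymmetricStableLevy {Ω : Type*} [MeasurableSpace Ω] (P : Measure Ω) (α : ℝ)
    (L : ℝ≥0 → Ω → ℝ) : Prop where
  measurable : ∀ t, Measurable (L t)
  start : ∀ᵐ ω ∂P, L 0 ω = 0
  cadlag : ∀ᵐ ω ∂P, ∀ T : ℝ, IsCadlagOn (fun t => L t.toNNReal ω) 0 T
  indep : HasIndepIncrements L P
  stationary : ∀ s t : ℝ≥0, IdentDistrib (fun ω => L (s + t) ω - L s ω) (L t) P P
  stable : ∀ t : ℝ≥0, 0 < t → IdentDistrib (fun ω => (t : ℝ) ^ (-(1 / α)) * L t ω) (L 1) P P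
  nonzero : ¬ ∀ t, ∀ᵐ ω ∂P, L t ω = 0
  brownian : α = 2 → IsBrownianReal L P
  symmetric : ∀ t, IdentDistrib (L t) (fun ω => -L t ω) P P

/-- `I` is (a version of) the stochastic integral `∫_{a+}^b f(s) dL_s` of the deterministic
continuous integrand `f`: the limit in probability of the sums
`∑ f(t_{j+1}) (L_{t_{j+1}} - L_{t_j})` over the equidistant partitions of `[a, b]`. -/
def IsStochIntegral {Ω : Type*} [MeasurableSpace Ω] (P : Measure Ω) (L : ℝ≥0 → Ω → ℝ)
    (f : ℝ → ℝ) (a b : ℝ) (I : Ω → ℝ) : Prop :=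
  TendstoInMeasure P
    (fun (K : ℕ) ω => ∑ j ∈ Finset.range K,
      f (a + (j + 1) * ((b - a) / K)) *
        (L (a + (j + 1) * ((b - a) / K)).toNNReal ω - L (a + j * ((b - a) / K)).toNNReal ω))
    atTop I

/-- A risk measure with values in `ℝ ∪ {+∞}`: law-invariant and positively homogeneous (with
`0 * (+∞) = 0`). Positions outside the natural domain of the risk measure get the value `+∞`. -/
structure IsRiskMeasure {Ω : Type*} [MeasurableSpace Ω] (P : Measure Ω)
    (ρ : (Ω → ℝ) → EReal) : Prop where
  ne_bot : ∀ Y, AEMeasurable Y P → ρ Y ≠ ⊥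
  law_inv : ∀ Y Z, IdentDistrib Y Z P P → ρ Y = ρ Z
  pos_hom : ∀ (β : ℝ) (Y : Ω → ℝ), 0 ≤ β → AEMeasurable Y P →
    ρ (fun ω => β * Y ω) = (β : EReal) * ρ Y

/-- Adding a sure amount of cash reduces the risk by that amount. -/
def CashInvariant {Ω : Type*} [MeasurableSpace Ω] (P : Measure Ω) (ρ : (Ω → ℝ) → EReal) : Prop :=
  ∀ (Y : Ω → ℝ) (m : ℝ), AEMeasurable Y P → ρ (fun ω => Y ω + m) = ρ Y - (m : EReal)

/-- Adding a sure amount of cash does not change the risk. -/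
def ShiftInvariant {Ω : Type*} [MeasurableSpace Ω] (P : Measure Ω) (ρ : (Ω → ℝ) → EReal) : Prop :=
  ∀ (Y : Ω → ℝ) (m : ℝ), AEMeasurable Y P → ρ (fun ω => Y ω + m) = ρ Y

/-- A discrete-time control law with bound `M`: `u k y` is the amount of money invested in the
risky asset during the period `(k, k + 1]` when the wealth at time `k` is `y`. -/
def IsControlLaw (M : ℝ) (u : ℕ → ℝ → ℝ) : Prop :=
  ∀ k, Measurable (u k) ∧ ∀ y, |u k y| ≤ M

/-- `X` is the wealth process on `[n, N]` started from the wealth `x` at time `n` under the control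
law `u`: a càdlàg solution of `dX_t = (r X_t + u_t (μ_t - r)) dt + u_t σ_t dL_t`, `X_n = x`, where
`u_t = u k (X_k)` for `t ∈ (k, k + 1]`. -/
structure IsWealthProcess {Ω : Type*} [MeasurableSpace Ω] (P : Measure Ω) (L : ℝ≥0 → Ω → ℝ)
    (r : ℝ) (μ σ : ℝ → ℝ) (N : ℕ) (u : ℕ → ℝ → ℝ) (n : ℕ) (x : ℝ) (X : ℝ → Ω → ℝ) : Prop where
  measurable : ∀ t, Measurable (X t)
  cadlag : ∀ᵐ ω ∂P, IsCadlagOn (fun t => X t ω) n N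
  start : ∀ᵐ ω ∂P, X n ω = x
  sde : ∀ k : ℕ, n ≤ k → k < N → ∀ t ∈ Icc (k : ℝ) (k + 1),
    ∃ I : Ω → ℝ, IsStochIntegral P L σ k t I ∧
      ∀ᵐ ω ∂P, X t ω = X k ω + (∫ s in (k : ℝ)..t, (r * X s ω + u k (X k ω) * (μ s - r)))
        + u k (X k ω) * I ω

/-- The extension of a non-decreasing `F : ℝ → ℝ` to `ℝ ∪ {+∞}` by its limit at `+∞`. -/
def extendTop (F : ℝ → ℝ) (y : EReal) : EReal :=
  if y = ⊤ then ⨆ x : ℝ, (F x : EReal) else (F y.toReal : EReal)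

/-- The value functional
`J_n(x, u) = E_{n,x}[R(X_N - x e^{r(N-n)})] - λ_n F(ρ_{n,x}(X_N - x e^{r(N-n)}))`. Here `X n x u` is
the wealth process under `u` started from `x` at time `n`; its law is the conditional law given
that the wealth at time `n` is `x`, on which `E_{n,x}` and `ρ_{n,x}` depend. -/
def valueFunctional {Ω : Type*} [MeasurableSpace Ω] (P : Measure Ω) (r : ℝ) (N : ℕ)
    (R F : ℝ → ℝ) (lam : ℝ → ℝ) (ρ : (Ω → ℝ) → EReal)
    (X : ℕ → ℝ → (ℕ → ℝ → ℝ) → ℝ → Ω → ℝ) (n : ℕ) (x : ℝ) (u : ℕ → ℝ → ℝ) : EReal :=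
  ((∫ ω, R (X n x u N ω - x * Real.exp (r * (N - n))) ∂P : ℝ) : EReal)
    - (lam n : EReal) * extendTop F (ρ fun ω => X n x u N ω - x * Real.exp (r * (N - n)))

/-- `u` is optimal in the time-consistent sense, i.e. a perfect subgame Nash equilibrium for the
value functional `J`: at every time `n < N` and wealth `x`, no change of the control at time `n`
alone, the later ones being kept, improves `J n x`. -/
def IsNashEquilibrium (M : ℝ) (N : ℕ) (J : ℕ → ℝ → (ℕ → ℝ → ℝ) → EReal)
    (u : ℕ → ℝ → ℝ) : Prop :=
  IsControlLaw M u ∧ ∀ n < N, ∀ x : ℝ,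
    (⨆ v : Icc (-M) M, J n x (Function.update u n fun _ => (v : ℝ))) = J n x u

/-- The data do not degenerate in period `n` (so that the objective is not flat in the control):
the reward `R` is not affine, or it is not constant and the excess return does not vanish on
`[n, n + 1]`, or positive risk is really penalised and, unless the risk measure is
shift-invariant, the excess return vanishes from time `n` on. -/
def NonDegenerateAt {Ω : Type*} [MeasurableSpace Ω] (P : Measure Ω) (L : ℝ≥0 → Ω → ℝ)
    (r : ℝ) (μ : ℝ → ℝ) (N : ℕ) (R F : ℝ → ℝ) (ρ : (Ω → ℝ) → EReal) (n : ℕ) : Prop :=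
  (¬ ∃ a b : ℝ, ∀ y, R y = a * y + b) ∨
  ((∃ y z, R y ≠ R z) ∧ ∃ s ∈ Icc (n : ℝ) (n + 1), r < μ s) ∨
  (0 < ρ (L 1) ∧ (∀ y, 0 < y → F 0 < F y) ∧
    (ShiftInvariant P ρ ∨ ∀ s ∈ Icc (n : ℝ) N, μ s = r))

end

/-!
Under a control that is constant in every period, the gain `X_N - x e^{r(N-n)}` is distributed as
`m + s L_1`. Here the shift `m` is linear in the amounts invested, with non-negative coefficients
(`excessReturn`), and the scale `s` is a weighted `ℓ^α`-norm of them (`noisePower`). So the problem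
at time `n` is to maximise, over the amount `v` invested now,
`E[R(m + s L_1)] - λ_n F(s ρ(L_1) - κ m)`, with `κ = 1` for a cash-invariant and `κ = 0` for a
shift-invariant risk measure (`valueFunctional_eq_shiftScaleValue`).

*Non-negativity* (`shiftScaleValue_lt_of_neg`). Passing from `v < 0` to `0` raises the shift and
lowers the scale. The reward `R` is non-decreasing and concave and `L_1` is symmetric, so the
expected reward does not decrease. The penalty does not increase: for `ρ(L_1) ≥ 0` because the risk
falls, for `ρ(L_1) < 0` because the risk of not investing is at most `0`, where `F` is
minimal. The latter uses that the later investments are non-negative, whence a backward induction.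
In each non-degenerate case one of the two comparisons is strict. For the reward this rests on the
law of `L_1` being unbounded (`IsSymmetricStableLevy.measure_gt_ne_zero`), which follows from
`L_2 = 2^{1/α} L_1` in law with `1/α < 1`: a concave function that is not affine loses strictly
under large symmetric spreads, and one that is not constant increases strictly near `-∞`.

*Feedback controls.* If `R` is strictly concave, the objective is strictly midpoint concave in
`v ≥ 0` (`shiftScaleValue_midpoint_lt`), since the scale is convex in `v` by Minkowski's
inequality. Hence the maximiser is unique and an equilibrium does not depend on the wealth, and the
backward induction reduces to controls that are constant in every later period.

*The law of the gain* (`IsWealthProcess.identDistrib`). Along each path, summation by parts writes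
the gain, less its drift part, as a limit of discounted Riemann sums of the noise increments over
cells of length `1 / K` (`tendsto_sum_exp_mul_noise`). Each of these increments is a limit in
probability of sums of increments of `L`, and on grids of mesh `1 / (K p)` all of them together form
a linear combination of independent stable variables, whose scale is explicit
(`IsSymmetricStableLevy.identDistrib_sum_increments`). The scales converge as `p → ∞` and then
`K → ∞`, and such limits preserve the form of the law (`identDistrib_mul_of_tendstoInMeasure`).
-/

/-! ### Convergence in probability and limits of scaled copies of a fixed law -/

section ConvergenceInMeasure

variable {Ω : Type*} [MeasurableSpace Ω] {P : Measure Ω}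

theorem tendstoInMeasure_add {ι : Type*} {l : Filter ι} {f f' : ι → Ω → ℝ} {g g' : Ω → ℝ}
    (h : TendstoInMeasure P f l g) (h' : TendstoInMeasure P f' l g') :
    TendstoInMeasure P (fun i ω => f i ω + f' i ω) l (fun ω => g ω + g' ω) := by
  rw [tendstoInMeasure_iff_norm] at h h' ⊢
  intro ε hε
  have h2 := (h (ε / 2) (half_pos hε)).add (h' (ε / 2) (half_pos hε))
  rw [add_zero] at h2
  refine tendsto_of_tendsto_of_tendsto_of_le_of_le tendsto_const_nhds h2 (fun _ => zero_le) ?_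
  intro i
  refine (measure_mono ?_).trans (measure_union_le _ _)
  intro ω hω
  by_contra hc
  simp only [mem_union, mem_ofPred_eq, not_or, not_le, Real.norm_eq_abs] at hc hω
  have := abs_add_le (f i ω - g ω) (f' i ω - g' ω)
  rw [show f i ω - g ω + (f' i ω - g' ω) = f i ω + f' i ω - (g ω + g' ω) by ring] at this
  linarith

theorem tendstoInMeasure_const_mul {ι : Type*} {l : Filter ι} {f : ι → Ω → ℝ} {g : Ω → ℝ}
    (h : TendstoInMeasure P f l g) (c : ℝ) :
    TendstoInMeasure P (fun i ω => c * f i ω) l (fun ω => c * g ω) := by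
  rw [tendstoInMeasure_iff_norm] at h ⊢
  intro ε hε
  rcases eq_or_ne c 0 with rfl | hc
  · have : ∀ i, P {x | ε ≤ ‖0 * f i x - 0 * g x‖} = 0 := fun i => by simp [not_le.2 hε]
    simp only [this]
    exact tendsto_const_nhds
  · refine (h (ε / |c|) (by positivity)).congr fun i => ?_
    congr 1
    ext ω
    simp only [mem_ofPred_eq, ← mul_sub, norm_mul, Real.norm_eq_abs]
    rw [div_le_iff₀ (by positivity), mul_comm]

theorem tendstoInMeasure_finset_sum {ι κ : Type*} {l : Filter ι} {f : κ → ι → Ω → ℝ}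
    {g : κ → Ω → ℝ} (s : Finset κ) (h : ∀ k ∈ s, TendstoInMeasure P (f k) l (g k)) :
    TendstoInMeasure P (fun i ω => ∑ k ∈ s, f k i ω) l (fun ω => ∑ k ∈ s, g k ω) := by
  classical
  induction s using Finset.induction_on with
  | empty =>
    rw [tendstoInMeasure_iff_norm]
    intro ε hε
    simp [not_le.2 hε, tendsto_const_nhds]
  | insert a s ha ih =>
    simp only [Finset.sum_insert ha]
    exact tendstoInMeasure_add (h a (Finset.mem_insert_self a s))
      (ih fun k hk => h k (Finset.mem_insert_of_mem hk))

/-- A limit in probability of variables distributed as `s i * Y` is distributed as `s * Y`, where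
`s` is the limit of the scales `s i`. -/
theorem identDistrib_mul_of_tendstoInMeasure [IsProbabilityMeasure P] {T : ℕ → Ω → ℝ}
    {V Y : Ω → ℝ} {s : ℕ → ℝ} {s' : ℝ} (hY : Measurable Y)
    (hT : ∀ i, 0 < i → IdentDistrib (T i) (fun ω => s i * Y ω) P P)
    (hTV : TendstoInMeasure P T atTop V) (hs : Tendsto s atTop (𝓝 s')) :
    IdentDistrib V (fun ω => s' * Y ω) P P := by
  have hT' : ∀ i, IdentDistrib (T (i + 1)) (fun ω => s (i + 1) * Y ω) P P :=
    fun i => hT (i + 1) i.succ_pos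
  have hTV' : TendstoInMeasure P (fun i => T (i + 1)) atTop V := hTV.comp (tendsto_add_atTop_nat 1)
  have hTm : ∀ i, AEMeasurable (T (i + 1)) P := fun i => (hT' i).aemeasurable_fst
  have h1 := hTV'.tendstoInDistribution hTm
  have h2 : TendstoInDistribution (fun i ω => s (i + 1) * Y ω) atTop (fun ω => s' * Y ω)
      (fun _ => P) P := by
    refine tendstoInDistribution_of_ae_tendsto (fun i => (hY.const_mul _).aemeasurable)
      (hY.const_mul _).aemeasurable
      (ae_of_all _ fun ω => (hs.comp (tendsto_add_atTop_nat 1)).mul_const _)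
  have h3 : TendstoInDistribution (fun i => T (i + 1)) atTop (fun ω => s' * Y ω)
      (fun _ => P) P := by
    refine ⟨hTm, (hY.const_mul _).aemeasurable, ?_⟩
    exact h2.tendsto.congr fun i => Subtype.ext (hT' i).map_eq.symm
  exact ⟨hTV'.aemeasurable hTm, (hY.const_mul _).aemeasurable,
    tendstoInDistribution_unique (fun i => T (i + 1)) h1 h3⟩

end ConvergenceInMeasure

/-! ### Linear combinations of increments of a symmetric stable process -/

namespace IsSymmetricStableLevy

variable {Ω : Type*} [MeasurableSpace Ω] {P : Measure Ω} {α : ℝ}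
  {L : ℝ≥0 → Ω → ℝ}

theorem identDistrib_rpow_mul (hL : IsSymmetricStableLevy P α L) (hα : 0 < α) (t : ℝ≥0) :
    IdentDistrib (L t) (fun ω => (t : ℝ) ^ (1 / α) * L 1 ω) P P := by
  rcases eq_or_lt_of_le (zero_le (a := t)) with rfl | ht
  · refine IdentDistrib.of_ae_eq (hL.measurable 0).aemeasurable ?_
    filter_upwards [hL.start] with ω hω
    rw [hω, NNReal.coe_zero, Real.zero_rpow (by positivity), zero_mul]
  · have h := (hL.stable t ht).comp (u := fun y => (t : ℝ) ^ (1 / α) * y) (by fun_prop)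
    have ht' : (0 : ℝ) < t := ht
    have e : (fun y : ℝ => (t : ℝ) ^ (1 / α) * y) ∘
        (fun ω => (t : ℝ) ^ (-(1 / α)) * L t ω) = L t := by
      funext ω
      simp only [Function.comp_apply]
      rw [← mul_assoc, ← Real.rpow_add ht', add_neg_cancel, Real.rpow_zero, one_mul]
    rw [e] at h
    exact h

theorem identDistrib_sub (hL : IsSymmetricStableLevy P α L) (hα : 0 < α) {s t : ℝ≥0}
    (hst : s ≤ t) :
    IdentDistrib (fun ω => L t ω - L s ω) (fun ω => ((t : ℝ) - s) ^ (1 / α) * L 1 ω) P P := by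
  have h := (hL.stationary s (t - s)).trans (hL.identDistrib_rpow_mul hα (t - s))
  rwa [add_tsub_cancel_of_le hst, NNReal.coe_sub hst] at h

/-- Replacing a scale by its absolute value does not change the law, by symmetry. -/
theorem identDistrib_abs_mul (hL : IsSymmetricStableLevy P α L) (c : ℝ) :
    IdentDistrib (fun ω => c * L 1 ω) (fun ω => |c| * L 1 ω) P P := by
  rcases abs_choice c with h | h <;> rw [h]
  · exact IdentDistrib.refl ((hL.measurable 1).const_mul _).aemeasurable
  · have := (hL.symmetric 1).comp (u := fun y => c * y) (by fun_prop)
    refine this.trans (IdentDistrib.of_ae_eq ?_ (ae_of_all _ fun ω => ?_))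
    · exact this.aemeasurable_snd
    · simp

variable [IsProbabilityMeasure P]

/-- Scales of independent copies add up in the `α`-norm: realise the two summands as the
increments of `L` over `(0, s ^ α]` and `(s ^ α, s ^ α + t ^ α]`. -/
theorem identDistrib_add (hL : IsSymmetricStableLevy P α L) (hα : 0 < α) {s t : ℝ} (hs : 0 ≤ s)
    (ht : 0 ≤ t) {T Y : Ω → ℝ} (hT : IdentDistrib T (fun ω => s * L 1 ω) P P)
    (hY : IdentDistrib Y (fun ω => t * L 1 ω) P P) (hind : IndepFun T Y P) :
    IdentDistrib (fun ω => T ω + Y ω) (fun ω => (s ^ α + t ^ α) ^ (1 / α) * L 1 ω) P P := by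
  have hsα : (0 : ℝ) ≤ s ^ α := Real.rpow_nonneg hs α
  have htα : (0 : ℝ) ≤ t ^ α := Real.rpow_nonneg ht α
  set a : ℝ≥0 := ⟨s ^ α, hsα⟩ with ha
  set b : ℝ≥0 := ⟨t ^ α, htα⟩ with hb
  have hroot : ∀ x : ℝ, 0 ≤ x → (x ^ α) ^ (1 / α) = x := fun x hx => by
    rw [← Real.rpow_mul hx, mul_one_div_cancel hα.ne', Real.rpow_one]
  have h1 : IdentDistrib (L a) T P P := by
    refine (hL.identDistrib_rpow_mul hα a).trans ?_
    have : ((a : ℝ≥0) : ℝ) = s ^ α := rfl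
    rw [this, hroot s hs]
    exact hT.symm
  have h2 : IdentDistrib (fun ω => L (a + b) ω - L a ω) Y P P := by
    refine (hL.identDistrib_sub hα (le_add_of_nonneg_right zero_le)).trans ?_
    have : ((a + b : ℝ≥0) : ℝ) - a = t ^ α := by
      rw [NNReal.coe_add, add_sub_cancel_left]; rfl
    rw [this, hroot t ht]
    exact hY.symm
  have hind2 : IndepFun (L a) (fun ω => L (a + b) ω - L a ω) P :=
    hL.indep.indepFun_eval_sub (r := 0) (s := a) (t := a + b) zero_le
      (le_add_of_nonneg_right zero_le) hL.start
  have h3 : IdentDistrib (fun ω => T ω + Y ω) (L (a + b)) P P := by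
    refine ⟨hT.aemeasurable_fst.add hY.aemeasurable_fst, (hL.measurable _).aemeasurable, ?_⟩
    have e1 := hind.map_add_eq_map_conv_map₀ hT.aemeasurable_fst hY.aemeasurable_fst
    have e2 := hind2.map_add_eq_map_conv_map₀ h1.aemeasurable_fst h2.aemeasurable_fst
    rw [h1.map_eq, h2.map_eq, ← e1] at e2
    have e3 : (L a + fun ω => L (a + b) ω - L a ω) = L (a + b) := by
      funext ω; simp
    rw [e3] at e2
    exact e2.symm
  exact h3.trans (hL.identDistrib_rpow_mul hα (a + b))

theorem identDistrib_finset_sum (hL : IsSymmetricStableLevy P α L) (hα : 0 < α) {ι : Type*}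
    {Y : ι → Ω → ℝ} (hYm : ∀ i, Measurable (Y i)) (hind : iIndepFun Y P) (c : ι → ℝ)
    (hY : ∀ i, IdentDistrib (Y i) (fun ω => c i * L 1 ω) P P) (s : Finset ι) :
    IdentDistrib (fun ω => ∑ i ∈ s, Y i ω) (fun ω => (∑ i ∈ s, |c i| ^ α) ^ (1 / α) * L 1 ω)
      P P := by
  classical
  induction s using Finset.induction_on with
  | empty =>
    simp only [Finset.sum_empty]
    rw [Real.zero_rpow (by positivity)]
    simp only [zero_mul]
    exact IdentDistrib.refl aemeasurable_const
  | insert i s hi ih =>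
    have hi1 : IdentDistrib (Y i) (fun ω => |c i| * L 1 ω) P P :=
      (hY i).trans (hL.identDistrib_abs_mul (c i))
    have hindep : IndepFun (fun ω => ∑ j ∈ s, Y j ω) (Y i) P := by
      have := hind.indepFun_finsetSum_of_notMem hYm hi
      convert this using 1
      funext ω
      simp
    have hnn : 0 ≤ ∑ j ∈ s, |c j| ^ α := Finset.sum_nonneg fun j _ => by positivity
    have key := hL.identDistrib_add hα (by positivity) (abs_nonneg _) ih hi1 hindep
    rw [← Real.rpow_mul hnn, one_div_mul_cancel hα.ne', Real.rpow_one] at key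
    simp only [Finset.sum_insert hi]
    rw [add_comm (|c i| ^ α)]
    simpa only [add_comm] using key

/-- The law of a linear combination of increments of `L` over distinct cells of the grid of mesh
`1 / m`. -/
theorem identDistrib_sum_increments (hL : IsSymmetricStableLevy P α L) (hα : 0 < α) {m : ℕ}
    (hm : 0 < m) {ι : Type*} (s : Finset ι) (f : ι → ℕ) (hf : Set.InjOn f s) (b : ι → ℝ) :
    IdentDistrib
      (fun ω => ∑ i ∈ s, b i * (L (((f i + 1 : ℕ) : ℝ) / m).toNNReal ω
        - L ((f i : ℝ) / m).toNNReal ω))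
      (fun ω => (∑ i ∈ s, |b i| ^ α / m) ^ (1 / α) * L 1 ω) P P := by
  have hm' : (0 : ℝ) < m := by exact_mod_cast hm
  let τ : ℕ → ℝ≥0 := fun l => ((l : ℝ) / m).toNNReal
  have hτ : Monotone τ := fun i j hij => Real.toNNReal_le_toNNReal (by gcongr)
  have hind := hL.indep.nat hτ
  have hind' := (hind.precomp (g := fun i : s => f i) (fun i j h => Subtype.ext (hf i.2 j.2 h))).comp
    (fun i : s => fun y : ℝ => b i * y) (fun i => by fun_prop)
  have hYm : ∀ i : s, Measurable ((fun y : ℝ => b i * y) ∘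
      fun ω => L (τ (f i + 1)) ω - L (τ (f i)) ω) :=
    fun i => (((hL.measurable _).sub (hL.measurable _)).const_mul _)
  have key := hL.identDistrib_finset_sum hα hYm hind' (fun i => b i * (1 / m : ℝ) ^ (1 / α))
    (fun i => by
      have h := (hL.identDistrib_sub hα (hτ (Nat.le_succ (f i)))).comp
        (u := fun y : ℝ => b i * y) (by fun_prop)
      have e : ((τ (f i + 1) : ℝ≥0) : ℝ) - τ (f i) = 1 / m := by
        simp only [τ]
        rw [Real.coe_toNNReal _ (by positivity), Real.coe_toNNReal _ (by positivity)]
        push_cast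
        ring
      simp only [Nat.succ_eq_add_one, e] at h
      refine h.trans (IdentDistrib.of_ae_eq h.aemeasurable_snd (ae_of_all _ fun ω => ?_))
      simp only [Function.comp_apply]
      ring) Finset.univ
  have e1 : ∀ i : s, |b i * (1 / m : ℝ) ^ (1 / α)| ^ α = |b i| ^ α / m := fun i => by
    have h0 : (0 : ℝ) ≤ (1 / m : ℝ) ^ (1 / α) := by positivity
    rw [abs_mul, abs_of_nonneg h0, Real.mul_rpow (abs_nonneg _) h0,
      ← Real.rpow_mul (by positivity), one_div_mul_cancel hα.ne', Real.rpow_one]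
    ring
  simp only [e1, Function.comp_apply] at key
  rw [Finset.sum_coe_sort s (fun i => |b i| ^ α / (m : ℝ))] at key
  convert key using 2 with ω
  exact (Finset.sum_coe_sort s (fun i => b i * (L (τ (f i + 1)) ω - L (τ (f i)) ω))).symm

end IsSymmetricStableLevy

/-! ### Riemann sums and càdlàg paths -/

theorem IsCadlagOn.exists_bound {f : ℝ → ℝ} {a b : ℝ} (hf : IsCadlagOn f a b) :
    ∃ C, ∀ t ∈ Icc a b, |f t| ≤ C := by
  refine (isCompact_Icc (a := a) (b := b)).induction_on (p := fun s => ∃ C, ∀ t ∈ s, |f t| ≤ C)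
    ⟨0, fun t ht => ht.elim⟩ (fun s t hst ⟨C, hC⟩ => ⟨C, fun x hx => hC x (hst hx)⟩)
    (fun s t ⟨C, hC⟩ ⟨D, hD⟩ => ⟨max C D, fun x hx => hx.elim
      (fun h => (hC x h).trans (le_max_left _ _)) (fun h => (hD x h).trans (le_max_right _ _))⟩) ?_
  intro x hx
  have hev : ∀ l : ℝ, ∀ F : Filter ℝ, Tendsto f F (𝓝 l) → ∀ᶠ t in F, |f t| ≤ |l| + 1 :=
    fun l F h => (h.abs.eventually (gt_mem_nhds (lt_add_one |l|))).mono fun t ht => ht.le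
  have hleft : ∃ C, ∀ᶠ t in 𝓝[<] x, t ∈ Icc a b → |f t| ≤ C := by
    rcases eq_or_lt_of_le hx.1 with h | h
    · refine ⟨0, eventually_nhdsWithin_of_forall fun t ht hta => ?_⟩
      exact absurd hta.1 (not_le.2 (h ▸ ht))
    · obtain ⟨l, hl⟩ := hf.2 x ⟨h, hx.2⟩
      exact ⟨_, (hev l _ hl).mono fun t ht _ => ht⟩
  have hright : ∃ C, ∀ᶠ t in 𝓝[≥] x, t ∈ Icc a b → |f t| ≤ C := by
    rcases eq_or_lt_of_le hx.2 with h | h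
    · refine ⟨|f x|, eventually_nhdsWithin_of_forall fun t ht htb => ?_⟩
      have : t = x := le_antisymm (h ▸ htb.2) ht
      rw [this]
    · exact ⟨_, (hev _ _ (hf.1 x ⟨hx.1, h⟩)).mono fun t ht _ => ht⟩
  obtain ⟨C, hC⟩ := hleft
  obtain ⟨D, hD⟩ := hright
  refine ⟨{t | t ∈ Icc a b ∧ |f t| ≤ max C D}, ?_, max C D, fun t ht => ht.2⟩
  have h : ∀ᶠ t in 𝓝 x, t ∈ Icc a b → |f t| ≤ max C D := by
    rw [← nhdsLT_sup_nhdsGE, eventually_sup]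
    exact ⟨hC.mono fun t ht h => (ht h).trans (le_max_left _ _),
      hD.mono fun t ht h => (ht h).trans (le_max_right _ _)⟩
  filter_upwards [eventually_nhdsWithin_of_eventually_nhds h, self_mem_nhdsWithin] with t h1 h2
  exact ⟨h2, h1 h2⟩

section RiemannSums

/-- The step function that on each cell of the partition of `[a, a + d]` into `K` intervals takes
the value of `w` at the right endpoint of the cell. -/
noncomputable def rightStep (w : ℝ → ℝ) (a d : ℝ) (K : ℕ) (s : ℝ) : ℝ :=
  w (a + ⌈(s - a) / (d / K)⌉ * (d / K))

theorem measurable_rightStep (w : ℝ → ℝ) (a d : ℝ) (K : ℕ) : Measurable (rightStep w a d K) := by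
  have h : Measurable fun z : ℤ => w (a + z * (d / K)) := measurable_from_top
  exact h.comp (Int.measurable_ceil.comp (by fun_prop))

theorem rightStep_eq {w : ℝ → ℝ} {a d : ℝ} (hd : 0 < d) {K j : ℕ} (hK : 0 < K) {s : ℝ}
    (hs : s ∈ Ioc (a + j * (d / K)) (a + (j + 1) * (d / K))) :
    rightStep w a d K s = w (a + (j + 1) * (d / K)) := by
  have hδ : 0 < d / K := by positivity
  have : ⌈(s - a) / (d / K)⌉ = (j : ℤ) + 1 := by
    rw [Int.ceil_eq_iff]
    push_cast
    rw [add_sub_cancel_right, lt_div_iff₀ hδ, div_le_iff₀ hδ]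
    constructor <;> linarith [hs.1, hs.2]
  rw [rightStep, this]
  push_cast
  rfl

theorem rightStep_mem {a d : ℝ} (hd : 0 < d) {K : ℕ} (hK : 0 < K) {s : ℝ}
    (hs : s ∈ Icc a (a + d)) : a + ⌈(s - a) / (d / K)⌉ * (d / K) ∈ Icc s (a + d) ∧
      a + ⌈(s - a) / (d / K)⌉ * (d / K) ≤ s + d / K := by
  have hK' : (0 : ℝ) < K := by exact_mod_cast hK
  have hδ : 0 < d / K := by positivity
  have h1 := Int.le_ceil ((s - a) / (d / K))
  have h2 := Int.ceil_lt_add_one ((s - a) / (d / K))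
  have h3 : (⌈(s - a) / (d / K)⌉ : ℝ) ≤ K := by
    have : ⌈(s - a) / (d / K)⌉ ≤ (K : ℤ) := by
      rw [Int.ceil_le]
      push_cast
      rw [div_le_iff₀ hδ, mul_div_cancel₀ _ hK'.ne']
      linarith [hs.2]
    exact_mod_cast this
  rw [div_le_iff₀ hδ] at h1
  have h4 : (⌈(s - a) / (d / K)⌉ : ℝ) * (d / K) ≤ ((s - a) / (d / K) + 1) * (d / K) := by gcongr
  rw [add_mul, div_mul_cancel₀ _ hδ.ne', one_mul] at h4
  have h5 : (⌈(s - a) / (d / K)⌉ : ℝ) * (d / K) ≤ K * (d / K) := by gcongr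
  rw [mul_div_cancel₀ _ hK'.ne'] at h5
  refine ⟨⟨by linarith, by linarith⟩, by linarith⟩

theorem tendsto_rightStep {w : ℝ → ℝ} {a d : ℝ} (hd : 0 < d)
    (hw : ∀ t ∈ Ico a (a + d), ContinuousWithinAt w (Ici t) t) {s : ℝ} (hs : s ∈ Ico a (a + d)) :
    Tendsto (fun K => rightStep w a d K s) atTop (𝓝 (w s)) := by
  have hs' : s ∈ Icc a (a + d) := ⟨hs.1, hs.2.le⟩
  refine (hw s hs).tendsto.comp (tendsto_nhdsWithin_iff.2 ⟨?_, ?_⟩)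
  · have h0 : Tendsto (fun K : ℕ => s + d / K) atTop (𝓝 s) := by
      simpa using (tendsto_const_nhds (x := s)).add (tendsto_const_div_atTop_nhds_zero_nat d)
    refine tendsto_of_tendsto_of_tendsto_of_le_of_le' tendsto_const_nhds h0 ?_ ?_
    · filter_upwards [eventually_gt_atTop 0] with K hK using (rightStep_mem hd hK hs').1.1
    · filter_upwards [eventually_gt_atTop 0] with K hK using (rightStep_mem hd hK hs').2
  · filter_upwards [eventually_gt_atTop 0] with K hK using (rightStep_mem hd hK hs').1.1

/-- A bounded right-continuous function is integrable: it is a limit of step functions. -/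
theorem intervalIntegrable_of_rightContinuous {w : ℝ → ℝ} {a d C : ℝ} (hd : 0 < d)
    (hw : ∀ t ∈ Ico a (a + d), ContinuousWithinAt w (Ici t) t)
    (hC : ∀ t ∈ Icc a (a + d), |w t| ≤ C) : IntervalIntegrable w volume a (a + d) := by
  rw [intervalIntegrable_iff_integrableOn_Ico_of_le (by linarith)]
  have hm : AEStronglyMeasurable w (volume.restrict (Ico a (a + d))) := by
    refine aestronglyMeasurable_of_tendsto_ae atTop
      (fun K => (measurable_rightStep w a d K).aestronglyMeasurable) ?_
    filter_upwards [ae_restrict_mem measurableSet_Ico] with s hs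
    exact tendsto_rightStep hd hw hs
  refine Integrable.of_bound hm C ?_
  filter_upwards [ae_restrict_mem measurableSet_Ico] with s hs
  exact hC s ⟨hs.1, hs.2.le⟩

/-- Riemann–Stieltjes sums with the integrand evaluated at right endpoints converge for bounded
right-continuous integrands. -/
theorem tendsto_sum_mul_integral {w h : ℝ → ℝ} {a d C : ℝ} (hd : 0 < d)
    (hw : ∀ t ∈ Ico a (a + d), ContinuousWithinAt w (Ici t) t)
    (hC : ∀ t ∈ Icc a (a + d), |w t| ≤ C) (hh : IntervalIntegrable h volume a (a + d)) :
    Tendsto (fun K : ℕ => ∑ j ∈ Finset.range K, w (a + (j + 1) * (d / K)) *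
      ∫ s in (a + j * (d / K))..(a + (j + 1) * (d / K)), h s) atTop
      (𝓝 (∫ s in a..(a + d), w s * h s)) := by
  have hlim : Tendsto (fun K => ∫ s in a..(a + d), rightStep w a d K s * h s) atTop
      (𝓝 (∫ s in a..(a + d), w s * h s)) := by
    refine intervalIntegral.tendsto_integral_filter_of_dominated_convergence
      (fun s => C * |h s|) ?_ ?_ (hh.abs.const_mul C) ?_
    · refine Eventually.of_forall fun K => ?_
      exact (measurable_rightStep w a d K).aestronglyMeasurable.mul
        (intervalIntegrable_iff.1 hh).aestronglyMeasurable
    · filter_upwards [eventually_gt_atTop 0] with K hK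
      refine ae_of_all _ fun s hs => ?_
      rw [uIoc_of_le (by linarith)] at hs
      rw [Real.norm_eq_abs, abs_mul]
      refine mul_le_mul_of_nonneg_right (hC _ ?_) (abs_nonneg _)
      have := (rightStep_mem hd hK (Ioc_subset_Icc_self hs)).1
      exact ⟨hs.1.le.trans this.1, this.2⟩
    · have hne : ∀ᵐ s : ℝ, s ≠ a + d := by
        simp [ae_iff]
      filter_upwards [hne] with s hs1 hs
      rw [uIoc_of_le (by linarith)] at hs
      exact (tendsto_rightStep hd hw ⟨hs.1.le, lt_of_le_of_ne hs.2 hs1⟩).mul_const _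
  refine hlim.congr' ?_
  filter_upwards [eventually_gt_atTop 0] with K hK
  have hK' : (0 : ℝ) < K := by exact_mod_cast hK
  have hδ : 0 < d / K := by positivity
  let t : ℕ → ℝ := fun j => a + j * (d / K)
  have ht : ∀ j, t j ≤ t (j + 1) := fun j => by
    simp only [t]; push_cast; linarith
  have htK : t K = a + d := by simp only [t]; rw [mul_div_cancel₀ _ hK'.ne']
  have ht0 : t 0 = a := by simp [t]
  have hmono : Monotone t := monotone_nat_of_le_succ ht
  have hsub : ∀ j < K, IntervalIntegrable h volume (t j) (t (j + 1)) := fun j hj => by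
    refine hh.mono_set ?_
    rw [uIcc_of_le (ht j), uIcc_of_le (by linarith)]
    exact Icc_subset_Icc (ht0 ▸ hmono (Nat.zero_le j)) (htK ▸ hmono (Nat.succ_le_of_lt hj))
  have hstep : ∀ j, ∀ s ∈ Ioc (t j) (t (j + 1)),
      w (a + (j + 1) * (d / K)) * h s = rightStep w a d K s * h s := fun j s hs => by
    rw [rightStep_eq (j := j) hd hK]
    simpa [t] using hs
  have hint : ∀ j < K, IntervalIntegrable (fun s => rightStep w a d K s * h s) volume (t j)
      (t (j + 1)) := fun j hj => by
    refine ((hsub j hj).const_mul (w (a + (j + 1) * (d / K)))).congr ?_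
    rw [uIoc_of_le (ht j)]
    exact hstep j
  have hsum := intervalIntegral.sum_integral_adjacent_intervals hint
  rw [htK, ht0] at hsum
  rw [← hsum]
  refine Finset.sum_congr rfl fun j hj => ?_
  have e : a + ((j : ℝ) + 1) * (d / K) = t (j + 1) := by simp [t]
  rw [← intervalIntegral.integral_const_mul]
  conv_rhs => rw [e]
  refine intervalIntegral.integral_congr_ae (ae_of_all _ fun s hs => ?_)
  rw [uIoc_of_le (ht j)] at hs
  rw [← e]
  exact (hstep j s hs).symm

end RiemannSums

/-! ### Variation of constants along a càdlàg path -/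

/-- The discount weights `exp (r (T - s))` at left endpoints can be used in place of those at right
endpoints, since the two differ by a factor that tends to `1`. -/
theorem tendsto_sum_exp_mul_integral {h : ℝ → ℝ} {a : ℝ} (r T : ℝ)
    (hh : IntervalIntegrable h volume a (a + 1)) :
    Tendsto (fun K : ℕ => ∑ j ∈ Finset.range K, Real.exp (r * (T - (a + j / K))) *
      ∫ s in (a + j / K)..(a + (j + 1) / K), h s) atTop
      (𝓝 (∫ s in a..(a + 1), Real.exp (r * (T - s)) * h s)) := by
  have hcont : Continuous fun s : ℝ => Real.exp (r * (T - s)) := by fun_prop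
  obtain ⟨C, hC⟩ := (isCompact_Icc (a := a) (b := a + 1)).exists_bound_of_continuousOn
    hcont.continuousOn
  have h1 := tendsto_sum_mul_integral (w := fun s => Real.exp (r * (T - s))) one_pos
    (fun t _ => hcont.continuousWithinAt) (C := C) hC hh
  have h2 : Tendsto (fun K : ℕ => Real.exp (r * (1 / K))) atTop (𝓝 1) := by
    have := (tendsto_const_div_atTop_nhds_zero_nat (1 : ℝ)).const_mul r
    simpa [Function.comp_def] using (Real.continuous_exp.tendsto _).comp this
  have h3 := h2.mul h1
  rw [one_mul] at h3
  refine h3.congr fun K => ?_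
  rw [Finset.mul_sum]
  refine Finset.sum_congr rfl fun j _ => ?_
  rw [← mul_assoc, ← Real.exp_add]
  simp only [mul_one_div]
  congr 2
  ring

/-- Let `Z` be the integrated noise of a path `x` that solves `dx = (r x + g) dt + dZ` on
`[a, a + 1]`. Its discounted Riemann sums converge to the increment of the discounted path, corrected
by the discounted drift. Summation by parts moves the differences from `x` to the weights, so
that only integrals of `x` against continuous functions remain. -/
theorem tendsto_sum_exp_mul_noise {x g : ℝ → ℝ} {a : ℝ} (r T : ℝ)
    (hx : IsCadlagOn x a (a + 1)) (hg : IntervalIntegrable g volume a (a + 1)) :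
    Tendsto (fun K : ℕ => ∑ j ∈ Finset.range K, Real.exp (r * (T - (a + j / K))) *
      ((x (a + (j + 1) / K) - x a - ∫ s in a..(a + (j + 1) / K), (r * x s + g s))
        - (x (a + j / K) - x a - ∫ s in a..(a + j / K), (r * x s + g s)))) atTop
      (𝓝 (Real.exp (r * (T - (a + 1))) * x (a + 1) - Real.exp (r * (T - a)) * x a
        - ∫ s in a..(a + 1), Real.exp (r * (T - s)) * g s)) := by
  obtain ⟨C, hC⟩ := hx.exists_bound
  have hxi : IntervalIntegrable x volume a (a + 1) :=
    intervalIntegrable_of_rightContinuous one_pos hx.1 hC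
  have hh : IntervalIntegrable (fun s => r * x s + g s) volume a (a + 1) :=
    (hxi.const_mul r).add hg
  set W : ℝ → ℝ := fun s => Real.exp (r * (T - s)) with hW
  have hWc : Continuous W := by fun_prop
  have hWd : ∀ s, HasDerivAt W (-(r * W s)) s := fun s => by
    have h1 : HasDerivAt (fun s => r * (T - s)) (r * (-1)) s :=
      ((hasDerivAt_id s).const_sub T).const_mul r
    have := h1.exp
    convert this using 1
    simp only [hW]
    ring
  have hWint : ∀ p q, ∫ s in p..q, -(r * W s) = W q - W p := fun p q =>
    intervalIntegral.integral_eq_sub_of_hasDerivAt (fun s _ => hWd s)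
      (Continuous.intervalIntegrable (by fun_prop) _ _)
  have lim1 := tendsto_sum_exp_mul_integral r T hh
  have lim2 := tendsto_sum_mul_integral (w := x) (h := fun s => -(r * W s)) one_pos hx.1 hC
    (Continuous.intervalIntegrable (by fun_prop) _ _)
  have lim3 := ((tendsto_const_nhds (x := W (a + 1) * x (a + 1) - W a * x a)).sub lim2).sub lim1
  have e : W (a + 1) * x (a + 1) - W a * x a - (∫ s in a..(a + 1), x s * -(r * W s))
      - (∫ s in a..(a + 1), W s * (r * x s + g s))
      = W (a + 1) * x (a + 1) - W a * x a - ∫ s in a..(a + 1), W s * g s := by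
    have i1 : IntervalIntegrable (fun s => x s * -(r * W s)) volume a (a + 1) :=
      hxi.mul_continuousOn (Continuous.continuousOn (by fun_prop))
    have i2 : IntervalIntegrable (fun s => W s * (r * x s + g s)) volume a (a + 1) :=
      hh.continuousOn_mul hWc.continuousOn
    rw [sub_sub, ← intervalIntegral.integral_add i1 i2]
    congr 1
    refine intervalIntegral.integral_congr fun s _ => ?_
    ring
  rw [e] at lim3
  refine lim3.congr' ?_
  filter_upwards [eventually_gt_atTop 0] with K hK
  have hK' : (0 : ℝ) < K := by exact_mod_cast hK
  have tele : W (a + 1) * x (a + 1) - W a * x a = ∑ j ∈ Finset.range K,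
      (W (a + (j + 1) / K) * x (a + (j + 1) / K) - W (a + j / K) * x (a + j / K)) := by
    have := Finset.sum_range_sub (fun j : ℕ => W (a + j / K) * x (a + j / K)) K
    simp only [Nat.cast_add, Nat.cast_one, Nat.cast_zero, zero_div, add_zero, div_self hK'.ne']
      at this
    exact this.symm
  rw [tele, ← Finset.sum_sub_distrib, ← Finset.sum_sub_distrib]
  refine Finset.sum_congr rfl fun j hj => ?_
  have hj' : (j : ℝ) + 1 ≤ K := by exact_mod_cast Finset.mem_range.1 hj
  simp only [mul_one_div, hWint]
  have hp : ∀ q : ℝ, 0 ≤ q → q ≤ K → IntervalIntegrable (fun s => r * x s + g s) volume a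
      (a + q / K) := fun q h0 hq => by
    have hq1 : q / K ≤ 1 := (div_le_one hK').2 hq
    have hq0 : 0 ≤ q / K := by positivity
    refine hh.mono_set ?_
    rw [uIcc_of_le (by linarith), uIcc_of_le (by linarith)]
    exact Icc_subset_Icc le_rfl (by linarith)
  have := intervalIntegral.integral_interval_sub_left (hp (j + 1) (by positivity) hj')
    (hp j (by positivity) (by linarith))
  rw [← this]
  simp only [hW]
  ring

/-! ### The law of the terminal wealth under constant controls -/

/-- The excess return, discounted to the horizon, that one unit invested during `(k, k + 1]`
earns. -/
noncomputable def excessReturn (r : ℝ) (μ : ℝ → ℝ) (N k : ℕ) : ℝ :=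
  ∫ s in (k : ℝ)..(k + 1), Real.exp (r * (N - s)) * (μ s - r)

/-- The `α`-th power of the scale of the stable noise, discounted to the horizon, that one unit
invested during `(k, k + 1]` carries. -/
noncomputable def noisePower (α r : ℝ) (σ : ℝ → ℝ) (N k : ℕ) : ℝ :=
  ∫ s in (k : ℝ)..(k + 1), Real.exp (r * α * (N - s)) * σ s ^ α

/-- The Riemann sum of the stochastic integral of `σ` over the first `q` cells to the right of `k`
in the grid of mesh `1 / m`. -/
noncomputable def gridSum {Ω : Type*} (L : ℝ≥0 → Ω → ℝ) (σ : ℝ → ℝ) (m k q : ℕ) (ω : Ω) : ℝ :=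
  ∑ i ∈ Finset.range q, σ (((k * m + i + 1 : ℕ) : ℝ) / m) *
    (L (((k * m + i + 1 : ℕ) : ℝ) / m).toNNReal ω - L (((k * m + i : ℕ) : ℝ) / m).toNNReal ω)

theorem gridSum_sub_gridSum {Ω : Type*} (L : ℝ≥0 → Ω → ℝ) (σ : ℝ → ℝ) (m k j p : ℕ) (ω : Ω) :
    gridSum L σ m k ((j + 1) * p) ω - gridSum L σ m k (j * p) ω =
      ∑ i ∈ Finset.range p, σ (((k * m + j * p + i + 1 : ℕ) : ℝ) / m) *
        (L (((k * m + j * p + i + 1 : ℕ) : ℝ) / m).toNNReal ω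
          - L (((k * m + j * p + i : ℕ) : ℝ) / m).toNNReal ω) := by
  rw [gridSum, gridSum, add_mul, one_mul, Finset.sum_range_add, add_sub_cancel_left]
  simp only [add_assoc]

section TerminalWealth

variable {Ω : Type*} [MeasurableSpace Ω] {P : Measure Ω} {L : ℝ≥0 → Ω → ℝ}

/-- Along the partitions whose number of cells is a multiple of `j`, the sums that define the
stochastic integral over `[k, k + j / K]` run over a grid whose mesh does not depend on `j`. -/
theorem IsStochIntegral.tendstoInMeasure_gridSum {σ : ℝ → ℝ} {k j K : ℕ} (hj : 0 < j) (hK : 0 < K)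
    {I : Ω → ℝ} (hI : IsStochIntegral P L σ k (k + j / K) I) :
    TendstoInMeasure P (fun p => gridSum L σ (K * p) k (j * p)) atTop I := by
  have hsub : Tendsto (fun p : ℕ => j * p) atTop atTop :=
    tendsto_id.const_mul_atTop' hj
  refine TendstoInMeasure.congr' ?_ EventuallyEq.rfl (TendstoInMeasure.comp hI hsub)
  filter_upwards [eventually_gt_atTop 0] with p hp
  refine ae_of_all _ fun ω => ?_
  have hj' : (0 : ℝ) < j := by exact_mod_cast hj
  have hK' : (0 : ℝ) < K := by exact_mod_cast hK
  have hp' : (0 : ℝ) < p := by exact_mod_cast hp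
  have e : ∀ q : ℝ, (k : ℝ) + q * (((k : ℝ) + j / K - k) / ((j * p : ℕ) : ℝ))
      = (k * (K * p) + q) / ((K * p : ℕ) : ℝ) := fun q => by
    push_cast
    field_simp
    ring
  simp only [Function.comp_apply, gridSum]
  refine Finset.sum_congr rfl fun i _ => ?_
  rw [e, e]
  push_cast
  simp only [add_assoc]

/-- The noise accumulated since time `k` by a wealth process that invests the amount `c`. -/
noncomputable def accumulatedNoise (X : ℝ → Ω → ℝ) (r : ℝ) (μ : ℝ → ℝ) (c : ℝ) (k : ℕ) (t : ℝ)
    (ω : Ω) : ℝ :=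
  X t ω - X k ω - ∫ s in (k : ℝ)..t, (r * X s ω + c * (μ s - r))

theorem IsWealthProcess.tendstoInMeasure_gridSum {r x : ℝ} {μ σ : ℝ → ℝ} {N n : ℕ}
    {u : ℕ → ℝ → ℝ} {X : ℝ → Ω → ℝ} (hX : IsWealthProcess P L r μ σ N u n x X) {k : ℕ}
    (hnk : n ≤ k) (hkN : k < N) {c : ℝ} (hc : ∀ᵐ ω ∂P, u k (X k ω) = c) {j K : ℕ} (hK : 0 < K)
    (hjK : j ≤ K) :
    TendstoInMeasure P (fun p ω => c * gridSum L σ (K * p) k (j * p) ω) atTop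
      (accumulatedNoise X r μ c k (k + j / K)) := by
  have hK' : (0 : ℝ) < K := by exact_mod_cast hK
  rcases Nat.eq_zero_or_pos j with rfl | hj
  · have e1 : ∀ p ω, c * gridSum L σ (K * p) k (0 * p) ω = 0 := fun p ω => by simp [gridSum]
    have e2 : accumulatedNoise X r μ c k ((k : ℝ) + (0 : ℕ) / K) = fun _ => 0 := by
      funext ω
      simp [accumulatedNoise]
    simp only [e1, e2]
    rw [tendstoInMeasure_iff_norm]
    intro ε hε
    simp [not_le.2 hε]
  · have hj1 : (j : ℝ) / K ≤ 1 := (div_le_one hK').2 (by exact_mod_cast hjK)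
    obtain ⟨I, hI, hXI⟩ := hX.sde k hnk hkN (k + j / K)
      ⟨by linarith [show (0 : ℝ) ≤ j / K by positivity], by linarith⟩
    refine TendstoInMeasure.congr_right ?_
      (tendstoInMeasure_const_mul (hI.tendstoInMeasure_gridSum hj hK) c)
    filter_upwards [hXI, hc] with ω h1 h2
    rw [h2] at h1
    simp only [accumulatedNoise]
    linarith

theorem grid_index_injOn (s : Finset ℕ) (K p : ℕ) :
    Set.InjOn (fun q : ℕ × ℕ × ℕ => q.1 * (K * p) + q.2.1 * p + q.2.2)
      (s ×ˢ Finset.range K ×ˢ Finset.range p : Finset (ℕ × ℕ × ℕ)) := by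
  rintro ⟨k, j, i⟩ h ⟨k', j', i'⟩ h' heq
  simp only [Finset.coe_product, mem_prod, Finset.mem_coe, Finset.mem_range] at h h'
  obtain ⟨-, hj, hi⟩ := h
  obtain ⟨-, hj', hi'⟩ := h'
  simp only at heq
  have hp : 0 < p := by omega
  have e : ∀ a b c : ℕ, a * (K * p) + b * p + c = c + p * (b + K * a) := fun a b c => by ring
  rw [e, e] at heq
  have h1 : i = i' := by
    have := congrArg (· % p) heq
    simpa [Nat.add_mul_mod_self_left, Nat.mod_eq_of_lt hi, Nat.mod_eq_of_lt hi'] using this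
  subst h1
  have h2 : j + K * k = j' + K * k' := Nat.eq_of_mul_eq_mul_left hp (by omega)
  have h3 : j = j' := by
    have := congrArg (· % K) h2
    simpa [Nat.add_mul_mod_self_left, Nat.mod_eq_of_lt hj, Nat.mod_eq_of_lt hj'] using this
  subst h3
  have h4 : k = k' := Nat.eq_of_mul_eq_mul_left (show 0 < K by omega) (by omega)
  subst h4
  rfl

theorem continuousWithinAt_Ici_of_continuousOn_Icc {w : ℝ → ℝ} {a b t : ℝ}
    (hw : ContinuousOn w (Icc a b)) (ht : t ∈ Ico a b) : ContinuousWithinAt w (Ici t) t :=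
  (hw t (Ico_subset_Icc_self ht)).mono_of_mem_nhdsWithin
    (mem_of_superset (Icc_mem_nhdsGE ht.2) (Icc_subset_Icc_left ht.1))

/-- Convergence of the `α`-th powers of the scales within one cell of the coarse grid, as the fine
grid is refined. -/
theorem tendsto_sum_rpow_div {w : ℝ → ℝ} {k j K : ℕ} (hK : 0 < K) (hjK : j < K)
    (hw : ContinuousOn w (Icc (k : ℝ) (k + 1))) :
    Tendsto (fun p : ℕ => ∑ i ∈ Finset.range p,
      w (((k * (K * p) + j * p + i + 1 : ℕ) : ℝ) / (K * p : ℕ)) / (K * p : ℕ)) atTop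
      (𝓝 (∫ s in ((k : ℝ) + j / K)..(k + (j + 1) / K), w s)) := by
  have hK' : (0 : ℝ) < K := by exact_mod_cast hK
  have hjK' : ((j : ℝ) + 1) / K ≤ 1 := (div_le_one hK').2 (by exact_mod_cast hjK)
  have hj0 : (0 : ℝ) ≤ j / K := by positivity
  have hd : (0 : ℝ) < 1 / K := by positivity
  have hsum : (j : ℝ) / K + 1 / K = (j + 1) / K := by ring
  have hw' : ContinuousOn w (Icc ((k : ℝ) + j / K) (k + j / K + 1 / K)) :=
    hw.mono (Icc_subset_Icc (by linarith) (by linarith))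
  obtain ⟨C, hC⟩ := isCompact_Icc.exists_bound_of_continuousOn hw'
  have lim := tendsto_sum_mul_integral (h := fun _ => 1) hd
    (fun t ht => continuousWithinAt_Ici_of_continuousOn_Icc hw' ht) hC intervalIntegrable_const
  simp only [mul_one] at lim
  rw [add_assoc, hsum] at lim
  refine lim.congr' ?_
  filter_upwards [eventually_gt_atTop 0] with p hp
  have hp' : (0 : ℝ) < p := by exact_mod_cast hp
  refine Finset.sum_congr rfl fun i _ => ?_
  rw [intervalIntegral.integral_const, smul_eq_mul, mul_one, div_eq_mul_inv (w _)]
  congr 2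
  · push_cast
    field_simp
    ring
  · push_cast
    field_simp
    ring

/-- The noise of a wealth process, discounted to the horizon at the times `k + j / K`. -/
noncomputable def coarseNoise (X : ℝ → Ω → ℝ) (r : ℝ) (μ : ℝ → ℝ) (c : ℕ → ℝ) (n N K : ℕ)
    (ω : Ω) : ℝ :=
  ∑ k ∈ Finset.Ico n N, ∑ j ∈ Finset.range K, Real.exp (r * (N - (k + j / K))) *
    (accumulatedNoise X r μ (c k) k (k + (j + 1) / K) ω
      - accumulatedNoise X r μ (c k) k (k + j / K) ω)

/-- The law of the noise sums over the cells of length `1 / K`: replace each cell's noise by its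
Riemann sum over `p` subcells and let `p → ∞`. -/
theorem IsWealthProcess.identDistrib_coarseNoise [IsProbabilityMeasure P] {α : ℝ} (hα : 0 < α)
    (hL : IsSymmetricStableLevy P α L) {r x : ℝ} {μ σ : ℝ → ℝ} {N n : ℕ}
    (hσ : ContinuousOn σ (Icc 0 N))
    (hσ_pos : ∀ t ∈ Icc (0 : ℝ) N, 0 < σ t) {u : ℕ → ℝ → ℝ} {X : ℝ → Ω → ℝ}
    (hX : IsWealthProcess P L r μ σ N u n x X) {c : ℕ → ℝ}
    (hc : ∀ k, n ≤ k → k < N → ∀ᵐ ω ∂P, u k (X k ω) = c k) {K : ℕ} (hK : 0 < K) :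
    IdentDistrib (coarseNoise X r μ c n N K)
      (fun ω => (∑ k ∈ Finset.Ico n N, |c k| ^ α *
        ∑ j ∈ Finset.range K, Real.exp (r * α * (N - (k + j / K))) *
          ∫ s in ((k : ℝ) + j / K)..(k + (j + 1) / K), σ s ^ α) ^ (1 / α) * L 1 ω) P P := by
  have hsubk : ∀ k < N, Icc (k : ℝ) (k + 1) ⊆ Icc 0 N := fun k hk =>
    Icc_subset_Icc (by positivity) (by exact_mod_cast hk)
  have hσα : ∀ k < N, ContinuousOn (fun s => σ s ^ α) (Icc (k : ℝ) (k + 1)) := fun k hk =>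
    (hσ.mono (hsubk k hk)).rpow_const fun s hs => Or.inl (hσ_pos s (hsubk k hk hs)).ne'
  let W : ℝ → ℝ := fun s => Real.exp (r * (N - s))
  let Tp : ℕ → Ω → ℝ := fun p ω => ∑ k ∈ Finset.Ico n N, ∑ j ∈ Finset.range K, W (k + j / K) *
    (c k * gridSum L σ (K * p) k ((j + 1) * p) ω + -1 * (c k * gridSum L σ (K * p) k (j * p) ω))
  let Bp : ℕ → ℝ := fun p => ∑ k ∈ Finset.Ico n N, |c k| ^ α *
    ∑ j ∈ Finset.range K, Real.exp (r * α * (N - (k + j / K))) * ∑ i ∈ Finset.range p,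
      σ (((k * (K * p) + j * p + i + 1 : ℕ) : ℝ) / (K * p : ℕ)) ^ α / (K * p : ℕ)
  have hTp : TendstoInMeasure P Tp atTop (coarseNoise X r μ c n N K) := by
    have := tendstoInMeasure_finset_sum (P := P) (l := atTop) (Finset.Ico n N) fun k hk =>
      tendstoInMeasure_finset_sum (Finset.range K) fun j hj =>
        tendstoInMeasure_const_mul (tendstoInMeasure_add
          (hX.tendstoInMeasure_gridSum (Finset.mem_Ico.1 hk).1 (Finset.mem_Ico.1 hk).2
            (hc k (Finset.mem_Ico.1 hk).1 (Finset.mem_Ico.1 hk).2) hK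
            (Nat.succ_le_of_lt (Finset.mem_range.1 hj)))
          (tendstoInMeasure_const_mul
            (hX.tendstoInMeasure_gridSum (Finset.mem_Ico.1 hk).1 (Finset.mem_Ico.1 hk).2
              (hc k (Finset.mem_Ico.1 hk).1 (Finset.mem_Ico.1 hk).2) hK
              (Finset.mem_range.1 hj).le) (-1))) (W (k + j / K))
    refine TendstoInMeasure.congr_right (ae_of_all _ fun ω => ?_) this
    simp only [coarseNoise]
    refine Finset.sum_congr rfl fun k _ => Finset.sum_congr rfl fun j _ => ?_
    push_cast
    ring
  have hlaw : ∀ p, 0 < p → IdentDistrib (Tp p) (fun ω => Bp p ^ (1 / α) * L 1 ω) P P := by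
    intro p hp
    have hm : 0 < K * p := Nat.mul_pos hK hp
    have key := hL.identDistrib_sum_increments hα hm
      (Finset.Ico n N ×ˢ Finset.range K ×ˢ Finset.range p)
      (fun q : ℕ × ℕ × ℕ => q.1 * (K * p) + q.2.1 * p + q.2.2) (grid_index_injOn _ K p)
      (fun q => W (q.1 + q.2.1 / K) * (c q.1 *
        σ (((q.1 * (K * p) + q.2.1 * p + q.2.2 + 1 : ℕ) : ℝ) / (K * p : ℕ))))
    simp only [Finset.sum_product] at key
    have e1 : Tp p = fun ω => ∑ k ∈ Finset.Ico n N, ∑ j ∈ Finset.range K, ∑ i ∈ Finset.range p,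
        W (k + j / K) * (c k * σ (((k * (K * p) + j * p + i + 1 : ℕ) : ℝ) / (K * p : ℕ))) *
        (L (((k * (K * p) + j * p + i + 1 : ℕ) : ℝ) / (K * p : ℕ)).toNNReal ω
          - L (((k * (K * p) + j * p + i : ℕ) : ℝ) / (K * p : ℕ)).toNNReal ω) := by
      funext ω
      simp only [Tp]
      refine Finset.sum_congr rfl fun k _ => Finset.sum_congr rfl fun j _ => ?_
      rw [neg_one_mul, ← sub_eq_add_neg, ← mul_sub, gridSum_sub_gridSum, Finset.mul_sum,
        Finset.mul_sum]
      exact Finset.sum_congr rfl fun i _ => by ring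
    have e2 : Bp p = ∑ k ∈ Finset.Ico n N, ∑ j ∈ Finset.range K, ∑ i ∈ Finset.range p,
        |W (k + j / K) * (c k * σ (((k * (K * p) + j * p + i + 1 : ℕ) : ℝ) / (K * p : ℕ)))| ^ α
          / (K * p : ℕ) := by
      simp only [Bp, Finset.mul_sum]
      refine Finset.sum_congr rfl fun k hk => Finset.sum_congr rfl fun j hj =>
        Finset.sum_congr rfl fun i hi => ?_
      have hm' : (0 : ℝ) < (K * p : ℕ) := by exact_mod_cast hm
      have hgrid : ((k * (K * p) + j * p + i + 1 : ℕ) : ℝ) / (K * p : ℕ) ∈ Icc (0 : ℝ) N := by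
        refine ⟨by positivity, (div_le_iff₀ hm').2 ?_⟩
        have h1 : k + 1 ≤ N := (Finset.mem_Ico.1 hk).2
        have h2 : j + 1 ≤ K := Finset.mem_range.1 hj
        have h3 : i + 1 ≤ p := Finset.mem_range.1 hi
        have h4 : (j + 1) * p ≤ K * p := Nat.mul_le_mul_right p h2
        have h5 : (k + 1) * (K * p) ≤ N * (K * p) := Nat.mul_le_mul_right _ h1
        have : k * (K * p) + j * p + i + 1 ≤ N * (K * p) := by
          rw [add_mul, one_mul] at h4 h5
          omega
        exact_mod_cast this
      have hσp := hσ_pos _ hgrid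
      rw [abs_mul, abs_mul, abs_of_pos hσp, abs_of_pos (Real.exp_pos _),
        Real.mul_rpow (Real.exp_pos _).le (by positivity),
        Real.mul_rpow (abs_nonneg _) hσp.le, ← Real.exp_mul,
        show r * ((N : ℝ) - (k + j / K)) * α = r * α * (N - (k + j / K)) by ring]
      ring
    rw [e1, e2]
    exact key
  have hBp : Tendsto Bp atTop (𝓝 (∑ k ∈ Finset.Ico n N, |c k| ^ α *
      ∑ j ∈ Finset.range K, Real.exp (r * α * (N - (k + j / K))) *
        ∫ s in ((k : ℝ) + j / K)..(k + (j + 1) / K), σ s ^ α)) := by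
    refine tendsto_finsetSum _ fun k hk => Tendsto.const_mul _ ?_
    refine tendsto_finsetSum _ fun j hj => Tendsto.const_mul _ ?_
    exact tendsto_sum_rpow_div hK (Finset.mem_range.1 hj) (hσα k (Finset.mem_Ico.1 hk).2)
  exact identDistrib_mul_of_tendstoInMeasure (hL.measurable 1) hlaw hTp
    ((Real.continuous_rpow_const (by positivity)).tendsto _ |>.comp hBp)

/-- Under a control that is constant in every period, the terminal wealth exceeds its riskless part
by an affine function of one stable variable: the shift is linear in the amounts invested, and the
scale is their weighted `ℓ^α`-norm. The noise is approximated in probability by linear combinations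
of independent increments, first with the stochastic integral over each cell `[j / K, (j + 1) / K]`
left exact, then with these replaced by their own sums over `p` cells. -/
theorem IsWealthProcess.identDistrib [IsProbabilityMeasure P] {α : ℝ} (hα : 0 < α)
    (hL : IsSymmetricStableLevy P α L) {r x : ℝ} {μ σ : ℝ → ℝ} {N n : ℕ}
    (hμ : ContinuousOn μ (Icc 0 N)) (hσ : ContinuousOn σ (Icc 0 N))
    (hσ_pos : ∀ t ∈ Icc (0 : ℝ) N, 0 < σ t) {u : ℕ → ℝ → ℝ} {X : ℝ → Ω → ℝ}
    (hX : IsWealthProcess P L r μ σ N u n x X) (hnN : n ≤ N) {c : ℕ → ℝ}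
    (hc : ∀ k, n ≤ k → k < N → ∀ᵐ ω ∂P, u k (X k ω) = c k) :
    IdentDistrib (fun ω => X N ω - x * Real.exp (r * (N - n)))
      (fun ω => (∑ k ∈ Finset.Ico n N, c k * excessReturn r μ N k)
        + (∑ k ∈ Finset.Ico n N, |c k| ^ α * noisePower α r σ N k) ^ (1 / α) * L 1 ω) P P := by
  have hsubk : ∀ k < N, Icc (k : ℝ) (k + 1) ⊆ Icc 0 N := fun k hk =>
    Icc_subset_Icc (by positivity) (by exact_mod_cast hk)
  have hσα : ∀ k < N, ContinuousOn (fun s => σ s ^ α) (Icc (k : ℝ) (k + 1)) := fun k hk =>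
    (hσ.mono (hsubk k hk)).rpow_const fun s hs => Or.inl (hσ_pos s (hsubk k hk hs)).ne'
  let W : ℝ → ℝ := fun s => Real.exp (r * (N - s))
  -- the coarse noise sums converge along almost every path
  let m := ∑ k ∈ Finset.Ico n N, c k * excessReturn r μ N k
  have hTlim : ∀ᵐ ω ∂P, Tendsto (fun K => coarseNoise X r μ c n N K ω) atTop
      (𝓝 (X N ω - x * Real.exp (r * (N - n)) - m)) := by
    filter_upwards [hX.cadlag, hX.start] with ω hω hstart
    have hk : ∀ k ∈ Finset.Ico n N, Tendsto (fun K : ℕ => ∑ j ∈ Finset.range K, W (k + j / K) *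
        (accumulatedNoise X r μ (c k) k (k + (j + 1) / K) ω
          - accumulatedNoise X r μ (c k) k (k + j / K) ω)) atTop
        (𝓝 (W (k + 1) * X (k + 1) ω - W k * X k ω - c k * excessReturn r μ N k)) := by
      intro k hk
      obtain ⟨hk1, hk2⟩ := Finset.mem_Ico.1 hk
      have hk1' : (n : ℝ) ≤ k := by exact_mod_cast hk1
      have hk2' : (k : ℝ) + 1 ≤ N := by exact_mod_cast hk2
      have hcad : IsCadlagOn (fun t => X t ω) k (k + 1) :=
        ⟨fun t ht => hω.1 t ⟨hk1'.trans ht.1, ht.2.trans_le hk2'⟩,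
          fun t ht => hω.2 t ⟨hk1'.trans_lt ht.1, ht.2.trans hk2'⟩⟩
      have hμk : ContinuousOn (fun s => c k * (μ s - r)) (uIcc (k : ℝ) (k + 1)) := by
        rw [uIcc_of_le (by linarith)]
        exact ((hμ.mono (hsubk k hk2)).sub continuousOn_const).const_smul (c k)
      have lim := tendsto_sum_exp_mul_noise r N hcad hμk.intervalIntegrable
      have e : ∫ s in (k : ℝ)..(k + 1), Real.exp (r * (N - s)) * (c k * (μ s - r))
          = c k * excessReturn r μ N k := by
        rw [excessReturn, ← intervalIntegral.integral_const_mul]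
        exact intervalIntegral.integral_congr fun s _ => by ring
      rw [e] at lim
      exact lim
    have hsum := tendsto_finsetSum _ hk
    have tele : ∑ k ∈ Finset.Ico n N,
        (W (k + 1) * X (k + 1) ω - W k * X k ω - c k * excessReturn r μ N k)
        = X N ω - x * Real.exp (r * (N - n)) - m := by
      rw [Finset.sum_sub_distrib]
      have := Finset.sum_Ico_sub (fun k : ℕ => W k * X k ω) hnN
      simp only [Nat.cast_add, Nat.cast_one] at this
      rw [this]
      simp only [W, sub_self, mul_zero, Real.exp_zero, one_mul, hstart, m]
      ring
    rw [tele] at hsum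
    exact hsum
  have hB : Tendsto (fun K : ℕ => ∑ k ∈ Finset.Ico n N, |c k| ^ α *
      ∑ j ∈ Finset.range K, Real.exp (r * α * (N - (k + j / K))) *
        ∫ s in ((k : ℝ) + j / K)..(k + (j + 1) / K), σ s ^ α) atTop
      (𝓝 (∑ k ∈ Finset.Ico n N, |c k| ^ α * noisePower α r σ N k)) := by
    refine tendsto_finsetSum _ fun k hk => Tendsto.const_mul _ ?_
    refine tendsto_sum_exp_mul_integral (r * α) N (ContinuousOn.intervalIntegrable ?_)
    rw [uIcc_of_le (by linarith)]
    exact hσα k (Finset.mem_Ico.1 hk).2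
  have hT : ∀ K, 0 < K → IdentDistrib (coarseNoise X r μ c n N K) _ P P := fun K hK =>
    hX.identDistrib_coarseNoise hα hL hσ hσ_pos hc hK
  have hTm : ∀ K, AEStronglyMeasurable (coarseNoise X r μ c n N K) P := fun K => by
    rcases K.eq_zero_or_pos with rfl | hK
    · have : coarseNoise X r μ c n N 0 = fun _ => 0 := by
        funext ω
        simp [coarseNoise]
      rw [this]
      exact aestronglyMeasurable_const
    · exact (hT K hK).aemeasurable_fst.aestronglyMeasurable
  have hlaw := identDistrib_mul_of_tendstoInMeasure (hL.measurable 1) hT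
    (tendstoInMeasure_of_tendsto_ae hTm hTlim)
    ((Real.continuous_rpow_const (by positivity)).tendsto _ |>.comp hB)
  have := hlaw.comp (u := fun y => m + y) (by fun_prop)
  convert this using 1
  · funext ω
    simp
  · rfl

end TerminalWealth

theorem excessReturn_nonneg {r : ℝ} {μ : ℝ → ℝ} {N k : ℕ} (hk : k < N)
    (hμ_r : ∀ t ∈ Icc (0 : ℝ) N, r ≤ μ t) : 0 ≤ excessReturn r μ N k := by
  refine intervalIntegral.integral_nonneg (by linarith) fun s hs => ?_
  have hk' : (k : ℝ) + 1 ≤ N := by exact_mod_cast hk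
  have := hμ_r s ⟨k.cast_nonneg.trans hs.1, hs.2.trans hk'⟩
  exact mul_nonneg (Real.exp_pos _).le (by linarith)

theorem excessReturn_pos {r : ℝ} {μ : ℝ → ℝ} {N k : ℕ} (hk : k < N)
    (hμ : ContinuousOn μ (Icc 0 N)) (hμ_r : ∀ t ∈ Icc (0 : ℝ) N, r ≤ μ t)
    (h : ∃ s ∈ Icc (k : ℝ) (k + 1), r < μ s) : 0 < excessReturn r μ N k := by
  have hk' : (k : ℝ) + 1 ≤ N := by exact_mod_cast hk
  have hsub : Icc (k : ℝ) (k + 1) ⊆ Icc 0 N := Icc_subset_Icc k.cast_nonneg hk'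
  obtain ⟨s, hs, hrs⟩ := h
  refine intervalIntegral.integral_pos (by linarith) ?_ ?_ ⟨s, hs, ?_⟩
  · exact (Continuous.continuousOn (by fun_prop)).mul ((hμ.mono hsub).sub continuousOn_const)
  · intro t ht
    have := hμ_r t (hsub (Ioc_subset_Icc_self ht))
    exact mul_nonneg (Real.exp_pos _).le (by linarith)
  · exact mul_pos (Real.exp_pos _) (by linarith)

theorem excessReturn_eq_zero {r : ℝ} {μ : ℝ → ℝ} {N k : ℕ}
    (h : ∀ s ∈ Icc (k : ℝ) (k + 1), μ s = r) : excessReturn r μ N k = 0 := by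
  rw [excessReturn]
  refine intervalIntegral.integral_zero_ae (ae_of_all _ fun s hs => ?_)
  rw [uIoc_of_le (by linarith)] at hs
  rw [h s (Ioc_subset_Icc_self hs), sub_self, mul_zero]

theorem noisePower_pos {α r : ℝ} {σ : ℝ → ℝ} {N k : ℕ} (hk : k < N)
    (hσ : ContinuousOn σ (Icc 0 N)) (hσ_pos : ∀ t ∈ Icc (0 : ℝ) N, 0 < σ t) :
    0 < noisePower α r σ N k := by
  have hk' : (k : ℝ) + 1 ≤ N := by exact_mod_cast hk
  have hsub : Icc (k : ℝ) (k + 1) ⊆ Icc 0 N := Icc_subset_Icc k.cast_nonneg hk'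
  have hpos : ∀ s ∈ Icc (k : ℝ) (k + 1), 0 < Real.exp (r * α * (N - s)) * σ s ^ α := fun s hs =>
    mul_pos (Real.exp_pos _) (Real.rpow_pos_of_pos (hσ_pos s (hsub hs)) _)
  refine intervalIntegral.integral_pos (by linarith) ?_
    (fun s hs => (hpos s (Ioc_subset_Icc_self hs)).le)
    ⟨k, ⟨le_rfl, by linarith⟩, hpos _ ⟨le_rfl, by linarith⟩⟩
  exact (Continuous.continuousOn (by fun_prop)).mul
    ((hσ.mono hsub).rpow_const fun s hs => Or.inl (hσ_pos s (hsub hs)).ne')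

/-! ### The support of a symmetric stable law is unbounded -/

namespace IsSymmetricStableLevy

variable {Ω : Type*} [MeasurableSpace Ω] {P : Measure Ω} {α : ℝ} {L : ℝ≥0 → Ω → ℝ}

theorem measure_lt_neg (hL : IsSymmetricStableLevy P α L) (C : ℝ) :
    P {ω | L 1 ω < -C} = P {ω | C < L 1 ω} := by
  rw [show {ω | C < L 1 ω} = L 1 ⁻¹' Ioi C from rfl,
    (hL.symmetric 1).measure_mem_eq measurableSet_Ioi]
  congr 1
  ext ω
  simp only [mem_ofPred_eq, mem_preimage, mem_Ioi]
  exact lt_neg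

theorem exists_measure_lt_ne_zero (hL : IsSymmetricStableLevy P α L) (hα : 0 < α) :
    ∃ ε > 0, P {ω | ε < L 1 ω} ≠ 0 := by
  by_contra! hcon
  have h1 : ∀ᵐ ω ∂P, ∀ n : ℕ, L 1 ω ≤ 1 / ((n : ℝ) + 1) := by
    rw [ae_all_iff]
    intro n
    rw [ae_iff]
    simpa using hcon (1 / ((n : ℝ) + 1)) (by positivity)
  have h2 : ∀ᵐ ω ∂P, ∀ n : ℕ, -(1 / ((n : ℝ) + 1)) ≤ L 1 ω := by
    rw [ae_all_iff]
    intro n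
    rw [ae_iff]
    simp only [not_le]
    rw [hL.measure_lt_neg]
    exact hcon (1 / ((n : ℝ) + 1)) (by positivity)
  have hlim := tendsto_one_div_add_atTop_nhds_zero_nat (𝕜 := ℝ)
  have h0 : ∀ᵐ ω ∂P, L 1 ω = 0 := by
    filter_upwards [h1, h2] with ω h1 h2
    refine le_antisymm (ge_of_tendsto' hlim h1) ?_
    have := le_of_tendsto' hlim.neg h2
    simpa using this
  refine hL.nonzero fun t => ?_
  have := (hL.identDistrib_rpow_mul hα t).measure_mem_eq (s := {0}ᶜ)
    (measurableSet_singleton 0).compl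
  rw [ae_iff]
  have h0t : ∀ᵐ ω ∂P, (t : ℝ) ^ (1 / α) * L 1 ω = 0 := by
    filter_upwards [h0] with ω hω
    rw [hω, mul_zero]
  exact this.trans (ae_iff.1 h0t)

/-- If the law charges `(x, ∞)`, it charges `(2 ^ (1 - 1 / α) x, ∞)`: both of two independent copies
exceed `x` with positive probability, and their sum is `2 ^ (1 / α)` times another copy. -/
theorem measure_two_rpow_mul_lt_ne_zero (hL : IsSymmetricStableLevy P α L) (hα : 0 < α) {x : ℝ}
    (hx : P {ω | x < L 1 ω} ≠ 0) : P {ω | (2 : ℝ) ^ (1 - 1 / α) * x < L 1 ω} ≠ 0 := by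
  have h12 : (1 : ℝ≥0) ≤ 2 := one_le_two
  have hind : IndepFun (L 1) (fun ω => L 2 ω - L 1 ω) P :=
    hL.indep.indepFun_eval_sub (r := 0) zero_le h12 hL.start
  have hinc : IdentDistrib (fun ω => L 2 ω - L 1 ω) (L 1) P P := by
    have := hL.stationary 1 1
    rwa [one_add_one_eq_two] at this
  have h1 := hind.measure_inter_preimage_eq_mul (Ioi x) (Ioi x) measurableSet_Ioi measurableSet_Ioi
  rw [hinc.measure_mem_eq measurableSet_Ioi] at h1
  have hx' : P (L 1 ⁻¹' Ioi x) ≠ 0 := hx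
  have h2 : P (L 2 ⁻¹' Ioi (2 * x)) ≠ 0 := by
    intro h0
    have hle : P (L 1 ⁻¹' Ioi x ∩ (fun ω => L 2 ω - L 1 ω) ⁻¹' Ioi x) ≤ P (L 2 ⁻¹' Ioi (2 * x)) := by
      refine measure_mono fun ω hω => ?_
      have a1 : x < L 1 ω := hω.1
      have a2 : x < L 2 ω - L 1 ω := hω.2
      simp only [mem_preimage, mem_Ioi]
      linarith
    rw [h0, h1] at hle
    exact mul_ne_zero hx' hx' (le_antisymm hle zero_le)
  rw [(hL.identDistrib_rpow_mul hα 2).measure_mem_eq measurableSet_Ioi] at h2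
  convert h2 using 2
  ext ω
  simp only [mem_ofPred_eq, mem_preimage, mem_Ioi, NNReal.coe_ofNat]
  have hp : (0 : ℝ) < 2 ^ (1 / α) := by positivity
  rw [Real.rpow_sub two_pos, Real.rpow_one, div_mul_eq_mul_div, div_lt_iff₀ hp, mul_comm (L 1 ω)]

theorem measure_gt_ne_zero (hL : IsSymmetricStableLevy P α L) (hα : 1 < α) (C : ℝ) :
    P {ω | C < L 1 ω} ≠ 0 := by
  have hα0 : 0 < α := one_pos.trans hα
  obtain ⟨ε, hε, h⟩ := hL.exists_measure_lt_ne_zero hα0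
  have hiter : ∀ n : ℕ, P {ω | ((2 : ℝ) ^ (1 - 1 / α)) ^ n * ε < L 1 ω} ≠ 0 := by
    intro n
    induction n with
    | zero => simpa using h
    | succ n ih =>
      have := hL.measure_two_rpow_mul_lt_ne_zero hα0 ih
      rwa [← mul_assoc, ← pow_succ'] at this
  have hbase : (1 : ℝ) < 2 ^ (1 - 1 / α) :=
    Real.one_lt_rpow one_lt_two (sub_pos.2 ((div_lt_one hα0).2 hα))
  obtain ⟨n, hn⟩ := pow_unbounded_of_one_lt (C / ε) hbase
  rw [div_lt_iff₀ hε] at hn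
  exact fun h0 => hiter n (measure_mono_null (fun ω (hω : _ < _) => hn.trans hω) h0)

theorem measure_lt_ne_zero (hL : IsSymmetricStableLevy P α L) (hα : 1 < α) (C : ℝ) :
    P {ω | L 1 ω < C} ≠ 0 := by
  rw [← neg_neg C, hL.measure_lt_neg]
  exact hL.measure_gt_ne_zero hα _

end IsSymmetricStableLevy

/-! ### Expected concave rewards of a symmetric stable variable -/

section ConcaveReward

variable {R : ℝ → ℝ}

theorem ConcaveOn.le_lineMap (hR : ConcaveOn ℝ univ R) (x y : ℝ) {a : ℝ} (h0 : 0 ≤ a)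
    (h1 : a ≤ 1) : (1 - a) * R x + a * R y ≤ R ((1 - a) * x + a * y) :=
  hR.2 (mem_univ x) (mem_univ y) (sub_nonneg.2 h1) h0 (sub_add_cancel 1 a)

/-- A concave function loses under a symmetric spread. -/
theorem ConcaveOn.add_sub_le (hR : ConcaveOn ℝ univ R) (m : ℝ) {p q : ℝ} (hpq : |p| ≤ |q|) :
    R (m + q) + R (m - q) ≤ R (m + p) + R (m - p) := by
  rcases eq_or_ne q 0 with rfl | hq
  · have : p = 0 := by simpa using hpq
    rw [this]
  · have h1 : |p / q| ≤ 1 := by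
      rw [abs_div]
      exact (div_le_one (abs_pos.2 hq)).2 hpq
    obtain ⟨h2, h3⟩ := abs_le.1 h1
    have c1 := hR.le_lineMap (m + q) (m - q) (a := (1 - p / q) / 2) (by linarith) (by linarith)
    have c2 := hR.le_lineMap (m + q) (m - q) (a := (1 + p / q) / 2) (by linarith) (by linarith)
    have e : p / q * q = p := div_mul_cancel₀ p hq
    rw [show (1 - (1 - p / q) / 2) * (m + q) + (1 - p / q) / 2 * (m - q) = m + p by
      linear_combination e] at c1
    rw [show (1 - (1 + p / q) / 2) * (m + q) + (1 + p / q) / 2 * (m - q) = m - p by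
      linear_combination -e] at c2
    linarith

/-- A concave function that loses nothing under arbitrarily large symmetric spreads around some
point is affine. -/
theorem ConcaveOn.exists_affine (hR : ConcaveOn ℝ univ R) (m : ℝ)
    (h : ∀ q₀, ∃ q ≥ q₀, 2 * R m ≤ R (m + q) + R (m - q)) :
    ∃ a b : ℝ, ∀ y, R y = a * y + b := by
  have key : ∀ q > 0, 2 * R m ≤ R (m + q) + R (m - q) → ∀ t, 0 ≤ t → t ≤ q →
      R (m + t) = R m + t / q * (R (m + q) - R m) ∧
        R (m - t) = R m - t / q * (R (m + q) - R m) := by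
    intro q hq hle t ht0 htq
    have h0 := hR.add_sub_le m (p := 0) (q := t) (by simp)
    have h0q := hR.add_sub_le m (p := 0) (q := q) (by simp)
    simp only [add_zero, sub_zero] at h0 h0q
    have ht1 : t / q ≤ 1 := (div_le_one hq).2 htq
    have ht2 : 0 ≤ t / q := by positivity
    have e : t / q * q = t := div_mul_cancel₀ t hq.ne'
    have c1 := hR.le_lineMap m (m + q) ht2 ht1
    have c2 := hR.le_lineMap m (m - q) ht2 ht1
    rw [show (1 - t / q) * m + t / q * (m + q) = m + t by linear_combination e] at c1
    rw [show (1 - t / q) * m + t / q * (m - q) = m - t by linear_combination -e] at c2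
    have e2 : R (m - q) = 2 * R m - R (m + q) := by linarith
    rw [e2] at c2
    constructor <;> nlinarith
  refine ⟨R (m + 1) - R m, R m - (R (m + 1) - R m) * m, fun y => ?_⟩
  obtain ⟨q, hq, hle⟩ := h (max 1 |y - m|)
  have hq1 : 1 ≤ q := (le_max_left _ _).trans hq
  have hqy : |y - m| ≤ q := (le_max_right _ _).trans hq
  have hq0 : 0 < q := by linarith
  have k1 := (key q hq0 hle 1 zero_le_one hq1).1
  have ky := key q hq0 hle |y - m| (abs_nonneg _) hqy
  have hd : 1 / q * (R (m + q) - R m) = R (m + 1) - R m := by linarith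
  rcases abs_cases (y - m) with ⟨h1, -⟩ | ⟨h1, -⟩ <;> rw [h1] at ky
  · have := ky.1
    rw [add_sub_cancel] at this
    rw [this]
    linear_combination (y - m) * hd
  · have := ky.2
    rw [sub_neg_eq_add, add_sub_cancel] at this
    rw [this]
    linear_combination (y - m) * hd

/-- A concave function that is not affine strictly loses when a large symmetric spread is
enlarged. -/
theorem ConcaveOn.exists_add_sub_lt (hR : ConcaveOn ℝ univ R)
    (haff : ¬ ∃ a b : ℝ, ∀ y, R y = a * y + b) (m : ℝ) :
    ∃ q₀ > 0, ∀ p q, 0 ≤ p → p < q → q₀ ≤ q → R (m + q) + R (m - q) < R (m + p) + R (m - p) := by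
  have h := mt (hR.exists_affine m) haff
  push Not at h
  obtain ⟨q₀, hq₀⟩ := h
  refine ⟨max q₀ 1, by positivity, fun p q hp hpq hq => ?_⟩
  have hq0 : 0 < q := hp.trans_lt hpq
  have hlt := hq₀ q ((le_max_left _ _).trans hq)
  have hpq1 : p / q < 1 := (div_lt_one hq0).2 hpq
  have hp0 : 0 ≤ p / q := by positivity
  have e : p / q * q = p := div_mul_cancel₀ p hq0.ne'
  have c1 := hR.le_lineMap m (m + q) hp0 hpq1.le
  have c2 := hR.le_lineMap m (m - q) hp0 hpq1.le
  rw [show (1 - p / q) * m + p / q * (m + q) = m + p by linear_combination e] at c1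
  rw [show (1 - p / q) * m + p / q * (m - q) = m - p by linear_combination -e] at c2
  nlinarith

theorem ConcaveOn.exists_strictMonoOn_Iic (hR : ConcaveOn ℝ univ R) (hmono : Monotone R)
    (hne : ∃ y z, R y ≠ R z) : ∃ y, StrictMonoOn R (Iic y) := by
  obtain ⟨y, z, hyz, hlt⟩ : ∃ y z, y < z ∧ R y < R z := by
    obtain ⟨y, z, h⟩ := hne
    rcases lt_trichotomy y z with hlt | rfl | hlt
    · exact ⟨y, z, hlt, lt_of_le_of_ne (hmono hlt.le) h⟩
    · exact absurd rfl h
    · exact ⟨z, y, hlt, lt_of_le_of_ne (hmono hlt.le) h.symm⟩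
  refine ⟨y, fun w _ w' (hw' : w' ≤ y) hww' => ?_⟩
  have hs := hR.slope_anti_adjacent (mem_univ w) (mem_univ z) hww' (hw'.trans_lt hyz)
  have h1 : 0 < (R z - R w') / (z - w') :=
    div_pos (by linarith [hmono hw']) (by linarith)
  have h2 := h1.trans_le hs
  rw [div_pos_iff_of_pos_right (by linarith)] at h2
  linarith

end ConcaveReward

section ExpectedReward

variable {Ω : Type*} [MeasurableSpace Ω] {P : Measure Ω} {R : ℝ → ℝ} {Y : Ω → ℝ}

theorem integral_lt_integral_of_le_of_measure_ne_zero {f g : Ω → ℝ} (hf : Integrable f P)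
    (hg : Integrable g P) (hle : ∀ ω, f ω ≤ g ω) (hlt : P {ω | f ω < g ω} ≠ 0) :
    ∫ ω, f ω ∂P < ∫ ω, g ω ∂P := by
  rw [← sub_pos, ← integral_sub hg hf, integral_pos_iff_support_of_nonneg
    (fun ω => sub_nonneg.2 (hle ω)) (hg.sub hf), pos_iff_ne_zero]
  refine fun h0 => hlt (measure_mono_null (fun ω hω => ?_) h0)
  exact (sub_pos.2 hω).ne'

theorem integral_mono_shift (hint : ∀ a b : ℝ, Integrable (fun ω => R (a + b * Y ω)) P)
    (hmono : Monotone R) {m m' : ℝ} (hm : m ≤ m') (s : ℝ) :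
    ∫ ω, R (m + s * Y ω) ∂P ≤ ∫ ω, R (m' + s * Y ω) ∂P :=
  integral_mono (hint _ _) (hint _ _) fun ω => hmono (by linarith)

theorem integral_strictMono_shift (hint : ∀ a b : ℝ, Integrable (fun ω => R (a + b * Y ω)) P)
    (hR : ConcaveOn ℝ univ R) (hmono : Monotone R) (hne : ∃ y z, R y ≠ R z)
    (hY : ∀ C, P {ω | Y ω < C} ≠ 0) {m m' s : ℝ} (hm : m < m') (hs : 0 < s) :
    ∫ ω, R (m + s * Y ω) ∂P < ∫ ω, R (m' + s * Y ω) ∂P := by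
  obtain ⟨y, hy⟩ := hR.exists_strictMonoOn_Iic hmono hne
  refine integral_lt_integral_of_le_of_measure_ne_zero (hint _ _) (hint _ _)
    (fun ω => hmono (by linarith)) fun h0 => hY ((y - m') / s) ?_
  refine measure_mono_null (fun ω hω => ?_) h0
  have hω' : Y ω < (y - m') / s := hω
  rw [lt_div_iff₀ hs] at hω'
  exact hy (mem_Iic.2 (by linarith)) (mem_Iic.2 (by linarith)) (by linarith)

theorem integral_eq_integral_symm (hint : ∀ a b : ℝ, Integrable (fun ω => R (a + b * Y ω)) P)
    (hRm : Measurable R) (hsymm : IdentDistrib Y (fun ω => -Y ω) P P) (m s : ℝ) :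
    ∫ ω, R (m + s * Y ω) ∂P = ∫ ω, (R (m + s * Y ω) + R (m - s * Y ω)) / 2 ∂P := by
  have h1 := (hsymm.comp (u := fun y => R (m + s * y)) (by fun_prop)).integral_eq
  simp only [Function.comp_def, mul_neg, ← sub_eq_add_neg] at h1
  have hint' : Integrable (fun ω => R (m - s * Y ω)) P := by
    simpa [sub_eq_add_neg] using hint m (-s)
  rw [integral_div, integral_add (hint _ _) hint', ← h1]
  ring

theorem integrable_symm (hint : ∀ a b : ℝ, Integrable (fun ω => R (a + b * Y ω)) P) (m s : ℝ) :
    Integrable (fun ω => (R (m + s * Y ω) + R (m - s * Y ω)) / 2) P := by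
  have hint' : Integrable (fun ω => R (m - s * Y ω)) P := by
    simpa [sub_eq_add_neg] using hint m (-s)
  exact ((hint m s).add hint').div_const 2

theorem integral_anti_scale (hint : ∀ a b : ℝ, Integrable (fun ω => R (a + b * Y ω)) P)
    (hRm : Measurable R) (hR : ConcaveOn ℝ univ R)
    (hsymm : IdentDistrib Y (fun ω => -Y ω) P P) (m : ℝ) {s s' : ℝ} (hs : 0 ≤ s) (hss' : s ≤ s') :
    ∫ ω, R (m + s' * Y ω) ∂P ≤ ∫ ω, R (m + s * Y ω) ∂P := by
  rw [integral_eq_integral_symm hint hRm hsymm, integral_eq_integral_symm hint hRm hsymm m s]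
  refine integral_mono (integrable_symm hint m s') (integrable_symm hint m s) fun ω => ?_
  have := hR.add_sub_le m (p := s * Y ω) (q := s' * Y ω) (by
    rw [abs_mul, abs_mul, abs_of_nonneg hs, abs_of_nonneg (hs.trans hss')]
    gcongr)
  dsimp only
  linarith

theorem integral_strictAnti_scale (hint : ∀ a b : ℝ, Integrable (fun ω => R (a + b * Y ω)) P)
    (hRm : Measurable R) (hR : ConcaveOn ℝ univ R) (haff : ¬ ∃ a b : ℝ, ∀ y, R y = a * y + b)
    (hsymm : IdentDistrib Y (fun ω => -Y ω) P P) (hY : ∀ C, P {ω | C < Y ω} ≠ 0) (m : ℝ)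
    {s s' : ℝ} (hs : 0 ≤ s) (hss' : s < s') :
    ∫ ω, R (m + s' * Y ω) ∂P < ∫ ω, R (m + s * Y ω) ∂P := by
  rw [integral_eq_integral_symm hint hRm hsymm, integral_eq_integral_symm hint hRm hsymm m s]
  obtain ⟨q₀, hq₀, hlt⟩ := hR.exists_add_sub_lt haff m
  have hs' : 0 < s' := hs.trans_lt hss'
  refine integral_lt_integral_of_le_of_measure_ne_zero (integrable_symm hint m s')
    (integrable_symm hint m s) (fun ω => ?_) fun h0 => hY (q₀ / s') ?_
  · have := hR.add_sub_le m (p := s * Y ω) (q := s' * Y ω) (by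
      rw [abs_mul, abs_mul, abs_of_nonneg hs, abs_of_pos hs']
      gcongr)
    linarith
  · refine measure_mono_null (fun ω hω => ?_) h0
    have hω' : q₀ / s' < Y ω := hω
    have hYpos : 0 < Y ω := (div_pos hq₀ hs').trans hω'
    rw [div_lt_iff₀ hs', mul_comm] at hω'
    have := hlt (s * Y ω) (s' * Y ω) (by positivity) (by gcongr) hω'.le
    simp only [mem_ofPred_eq]
    linarith

theorem integral_midpoint_lt (hint : ∀ a b : ℝ, Integrable (fun ω => R (a + b * Y ω)) P)
    (hR : StrictConcaveOn ℝ univ R) (hY : ∀ C, P {ω | C < Y ω} ≠ 0) {m₁ m₂ s₁ s₂ : ℝ}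
    (hs : s₁ ≠ s₂) :
    (∫ ω, R (m₁ + s₁ * Y ω) ∂P + ∫ ω, R (m₂ + s₂ * Y ω) ∂P) / 2 <
      ∫ ω, R ((m₁ + m₂) / 2 + (s₁ + s₂) / 2 * Y ω) ∂P := by
  rw [← integral_add (hint _ _) (hint _ _), ← integral_div]
  have e : ∀ y, (m₁ + m₂) / 2 + (s₁ + s₂) / 2 * y
      = (1 / 2 : ℝ) • (m₁ + s₁ * y) + (1 / 2 : ℝ) • (m₂ + s₂ * y) := fun y => by
    simp only [smul_eq_mul]
    ring
  refine integral_lt_integral_of_le_of_measure_ne_zero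
    (((hint _ _).add (hint _ _)).div_const 2) (hint _ _) (fun ω => ?_)
    fun h0 => hY ((m₂ - m₁) / (s₁ - s₂)) ?_
  · have : (1 / 2 : ℝ) • R (m₁ + s₁ * Y ω) + (1 / 2 : ℝ) • R (m₂ + s₂ * Y ω) ≤ _ :=
      hR.concaveOn.2 (mem_univ _) (mem_univ _) (by norm_num) (by norm_num) (by norm_num)
    rw [← e] at this
    simp only [smul_eq_mul] at this
    linarith
  · refine measure_mono_null (fun ω hω => ?_) h0
    have hω' : (m₂ - m₁) / (s₁ - s₂) < Y ω := hω
    have hne : m₁ + s₁ * Y ω ≠ m₂ + s₂ * Y ω := fun h => by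
      refine hω'.ne ?_
      rw [div_eq_iff (sub_ne_zero.2 hs)]
      linarith
    have : (1 / 2 : ℝ) • R (m₁ + s₁ * Y ω) + (1 / 2 : ℝ) • R (m₂ + s₂ * Y ω) < _ :=
      hR.2 (mem_univ _) (mem_univ _) hne (by norm_num) (by norm_num) (by norm_num)
    rw [← e] at this
    simp only [smul_eq_mul] at this
    simp only [mem_ofPred_eq]
    linarith

end ExpectedReward

/-! ### The penalised objective as a function of shift and scale -/

section Penalty

variable {F : ℝ → ℝ}

theorem penalty_zero_le (hF : Differentiable ℝ F) (hF_conv : ConvexOn ℝ univ F)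
    (hF_zero : deriv F 0 = 0) (y : ℝ) : F 0 ≤ F y := by
  have := hF_conv.isMinOn_of_rightDeriv_eq_zero (x := 0) (by simp)
    (by rw [(hF 0).derivWithin (uniqueDiffWithinAt_Ioi 0), hF_zero])
  exact this (mem_univ y)

theorem penalty_eq_of_nonpos (hF : Differentiable ℝ F) (hF_mono : Monotone F)
    (hF_conv : ConvexOn ℝ univ F) (hF_zero : deriv F 0 = 0) {y : ℝ} (hy : y ≤ 0) : F y = F 0 :=
  le_antisymm (hF_mono hy) (penalty_zero_le hF hF_conv hF_zero y)

theorem penalty_strictMonoOn (hF_conv : ConvexOn ℝ univ F) (hF_pos : ∀ y, 0 < y → F 0 < F y) :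
    StrictMonoOn F (Ici 0) := by
  intro y (hy : 0 ≤ y) z _ hyz
  rcases eq_or_lt_of_le hy with rfl | hy
  · exact hF_pos z hyz
  · have hs := hF_conv.slope_mono_adjacent (mem_univ 0) (mem_univ z) hy hyz
    have h1 : 0 < (F y - F 0) / (y - 0) := div_pos (by linarith [hF_pos y hy]) (by linarith)
    have h2 := h1.trans_le hs
    rw [div_pos_iff_of_pos_right (by linarith)] at h2
    linarith

/-- The risk of the position `m + s L_1` is affine in `(m, s)`; the weight `κ` of the shift is `1`
for a cash-invariant and `0` for a shift-invariant risk measure. -/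
theorem IsRiskMeasure.exists_eq_affine {Ω : Type*} [MeasurableSpace Ω] {P : Measure Ω}
    {ρ : (Ω → ℝ) → EReal} (hρ : IsRiskMeasure P ρ)
    (hρ_inv : CashInvariant P ρ ∨ ShiftInvariant P ρ) {Y : Ω → ℝ} (hY : Measurable Y)
    (hρ_fin : ρ Y < ⊤) :
    ∃ κ : ℝ, 0 ≤ κ ∧ (ShiftInvariant P ρ → κ = 0) ∧ ∀ m s : ℝ, 0 ≤ s →
      ρ (fun ω => m + s * Y ω) = ((s * (ρ Y).toReal - κ * m : ℝ) : EReal) := by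
  have hcoe : ρ Y = ((ρ Y).toReal : EReal) :=
    (EReal.coe_toReal hρ_fin.ne (hρ.ne_bot Y hY.aemeasurable)).symm
  have hscale : ∀ s : ℝ, 0 ≤ s → ρ (fun ω => s * Y ω) = ((s * (ρ Y).toReal : ℝ) : EReal) :=
    fun s hs => by
      rw [hρ.pos_hom s Y hs hY.aemeasurable, EReal.coe_mul, ← hcoe]
  by_cases hshift : ShiftInvariant P ρ
  · refine ⟨0, le_rfl, fun _ => rfl, fun m s hs => ?_⟩
    have := hshift (fun ω => s * Y ω) m (hY.const_mul s).aemeasurable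
    simp only [add_comm m, this, hscale s hs, zero_mul, sub_zero]
  · refine ⟨1, zero_le_one, fun h => absurd h hshift, fun m s hs => ?_⟩
    have := hρ_inv.resolve_right hshift (fun ω => s * Y ω) m (hY.const_mul s).aemeasurable
    simp only [add_comm m, this, hscale s hs, one_mul, EReal.coe_sub]

end Penalty

/-- The value of a terminal gain that is distributed as `m + s Y`, when its risk is
`s ρ₁ - κ m`. -/
noncomputable def shiftScaleValue {Ω : Type*} [MeasurableSpace Ω] (P : Measure Ω) (R F : ℝ → ℝ)
    (Y : Ω → ℝ) (lam ρ₁ κ m s : ℝ) : ℝ :=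
  ∫ ω, R (m + s * Y ω) ∂P - lam * F (s * ρ₁ - κ * m)

/-- The scale of the terminal gain when the amount `v` is invested in a period of noise power `B`
and the later periods contribute the noise power `q`. -/
noncomputable def totalScale (α B q v : ℝ) : ℝ :=
  (|v| ^ α * B + q) ^ (1 / α)

section TotalScale

variable {α B q : ℝ}

theorem totalScale_nonneg (hB : 0 ≤ B) (hq : 0 ≤ q) (v : ℝ) : 0 ≤ totalScale α B q v := by
  rw [totalScale]
  positivity

theorem totalScale_lt (hα : 0 < α) (hB : 0 < B) (hq : 0 ≤ q) {v w : ℝ} (hvw : |v| < |w|) :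
    totalScale α B q v < totalScale α B q w := by
  have h := Real.rpow_lt_rpow (abs_nonneg v) hvw hα
  refine Real.rpow_lt_rpow (by positivity) ?_ (by positivity)
  have := mul_lt_mul_of_pos_right h hB
  linarith

/-- The scale is convex in the amount invested, by Minkowski's inequality in `ℓ^α`. -/
theorem totalScale_midpoint_le (hα : 1 ≤ α) (hB : 0 ≤ B) (hq : 0 ≤ q) (v w : ℝ) :
    totalScale α B q ((v + w) / 2) ≤ (totalScale α B q v + totalScale α B q w) / 2 := by
  have hα0 : 0 < α := by linarith
  have hroot : ∀ x : ℝ, 0 ≤ x → (x ^ (1 / α)) ^ α = x := fun x hx => by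
    rw [← Real.rpow_mul hx, one_div_mul_cancel hα0.ne', Real.rpow_one]
  have hB' : 0 ≤ B ^ (1 / α) := by positivity
  have hq' : 0 ≤ q ^ (1 / α) := by positivity
  have hnorm : ∀ v c : ℝ, 0 ≤ c →
      |v * B ^ (1 / α)| ^ α + |c * q ^ (1 / α)| ^ α = |v| ^ α * B + c ^ α * q := fun v c hc => by
    rw [abs_mul, abs_mul, abs_of_nonneg hB', abs_of_nonneg hq', abs_of_nonneg hc,
      Real.mul_rpow (abs_nonneg v) hB', Real.mul_rpow hc hq', hroot B hB, hroot q hq]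
  have h := Real.Lp_add_le (Finset.univ : Finset (Fin 2)) ![v * B ^ (1 / α), 1 * q ^ (1 / α)]
    ![w * B ^ (1 / α), 1 * q ^ (1 / α)] hα
  simp only [Fin.sum_univ_two, Matrix.cons_val_zero, Matrix.cons_val_one, ← add_mul] at h
  rw [hnorm _ _ zero_le_one, hnorm _ _ zero_le_one, hnorm _ _ (by norm_num), Real.one_rpow,
    one_mul, one_add_one_eq_two] at h
  have e : (|(v + w) / 2| ^ α * B + q) = (|v + w| ^ α * B + 2 ^ α * q) / 2 ^ α := by
    rw [abs_div, abs_two, Real.div_rpow (abs_nonneg _) two_pos.le]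
    field_simp
  have e2 : totalScale α B q ((v + w) / 2) = (|v + w| ^ α * B + 2 ^ α * q) ^ (1 / α) / 2 := by
    rw [totalScale, e, Real.div_rpow (by positivity) (by positivity),
      ← Real.rpow_mul two_pos.le, mul_one_div_cancel hα0.ne', Real.rpow_one]
  rw [e2]
  simp only [totalScale]
  linarith

end TotalScale

section ShiftScaleValue

variable {Ω : Type*} [MeasurableSpace Ω] {P : Measure Ω} {α : ℝ}
  {L : ℝ≥0 → Ω → ℝ} {R F : ℝ → ℝ} {lam ρ₁ κ A B q m : ℝ}

/-- Investing nothing beats going short, provided that the later periods do not lower the expected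
gain: it raises the shift and lowers the scale. If `ρ₁ < 0`, a lower scale means a higher risk, but
then the risk of not investing is negative and is not penalised. -/
theorem shiftScaleValue_lt_of_neg (hα : 1 < α) (hL : IsSymmetricStableLevy P α L)
    (hRm : Measurable R) (hR_mono : Monotone R) (hR_conc : ConcaveOn ℝ univ R)
    (hint : ∀ a b : ℝ, Integrable (fun ω => R (a + b * L 1 ω)) P)
    (hF : Differentiable ℝ F) (hF_mono : Monotone F) (hF_conv : ConvexOn ℝ univ F)
    (hF_zero : deriv F 0 = 0) (hlam : 0 < lam) (hκ : 0 ≤ κ) (hA : 0 ≤ A) (hB : 0 < B)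
    (hq : 0 ≤ q) (hm : 0 ≤ m)
    (hnd : (¬ ∃ a b : ℝ, ∀ y, R y = a * y + b) ∨ ((∃ y z, R y ≠ R z) ∧ 0 < A) ∨
      (0 < ρ₁ ∧ (∀ y, 0 < y → F 0 < F y) ∧ (κ = 0 ∨ A = 0 ∧ m = 0)))
    {v : ℝ} (hv : v < 0) :
    shiftScaleValue P R F (L 1) lam ρ₁ κ (v * A + m) (totalScale α B q v) <
      shiftScaleValue P R F (L 1) lam ρ₁ κ (0 * A + m) (totalScale α B q 0) := by
  have hα0 : 0 < α := by linarith
  rw [zero_mul, zero_add]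
  set s := totalScale α B q 0
  set s' := totalScale α B q v
  have hs : 0 ≤ s := totalScale_nonneg hB.le hq 0
  have hss' : s < s' := totalScale_lt hα0 hB hq (by simpa using hv.ne)
  have hm' : v * A + m ≤ m := by nlinarith
  have hshift := integral_mono_shift hint hR_mono hm' s'
  have hscale := integral_anti_scale hint hRm hR_conc (hL.symmetric 1) m hs hss'.le
  have hpen : F (s * ρ₁ - κ * m) ≤ F (s' * ρ₁ - κ * (v * A + m)) := by
    have hκm := mul_le_mul_of_nonneg_left hm' hκ
    rcases le_or_gt 0 ρ₁ with h | h
    · have := mul_le_mul_of_nonneg_right hss'.le h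
      exact hF_mono (by linarith)
    · have h1 : s * ρ₁ ≤ 0 := mul_nonpos_of_nonneg_of_nonpos hs h.le
      have h2 : 0 ≤ κ * m := mul_nonneg hκ hm
      rw [penalty_eq_of_nonpos hF hF_mono hF_conv hF_zero (by linarith)]
      exact penalty_zero_le hF hF_conv hF_zero _
  have hpen' := mul_le_mul_of_nonneg_left hpen hlam.le
  simp only [shiftScaleValue]
  rcases hnd with haff | ⟨hne, hApos⟩ | ⟨hρ₁, hFpos, hzero⟩
  · have := integral_strictAnti_scale hint hRm hR_conc haff (hL.symmetric 1)
      (hL.measure_gt_ne_zero hα) m hs hss'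
    linarith
  · have := integral_strictMono_shift hint hR_conc hR_mono hne (hL.measure_lt_ne_zero hα)
      (show v * A + m < m by nlinarith) (hs.trans_lt hss')
    linarith
  · have e1 : κ * m = 0 := by
      rcases hzero with h | ⟨-, h⟩ <;> rw [h] <;> ring
    have e2 : κ * (v * A + m) = 0 := by
      rcases hzero with h | ⟨h1, h2⟩
      · rw [h]; ring
      · rw [h1, h2]; ring
    have h := penalty_strictMonoOn hF_conv hFpos (mem_Ici.2 (mul_nonneg hs hρ₁.le))
      (mem_Ici.2 (mul_nonneg (hs.trans hss'.le) hρ₁.le)) (mul_lt_mul_of_pos_right hss' hρ₁)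
    have h' := mul_lt_mul_of_pos_left h hlam
    rw [e1, e2, sub_zero, sub_zero]
    linarith

/-- For a strictly concave reward the value is strictly midpoint concave in non-negative
investments. -/
theorem shiftScaleValue_midpoint_lt (hα : 1 < α) (hL : IsSymmetricStableLevy P α L)
    (hRm : Measurable R) (hR_conc : StrictConcaveOn ℝ univ R)
    (hint : ∀ a b : ℝ, Integrable (fun ω => R (a + b * L 1 ω)) P)
    (hF : Differentiable ℝ F) (hF_mono : Monotone F) (hF_conv : ConvexOn ℝ univ F)
    (hF_zero : deriv F 0 = 0) (hlam : 0 < lam) (hκ : 0 ≤ κ) (hA : 0 ≤ A) (hB : 0 < B)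
    (hq : 0 ≤ q) (hm : 0 ≤ m) {v w : ℝ} (hv : 0 ≤ v) (hvw : v < w) :
    (shiftScaleValue P R F (L 1) lam ρ₁ κ (v * A + m) (totalScale α B q v) +
      shiftScaleValue P R F (L 1) lam ρ₁ κ (w * A + m) (totalScale α B q w)) / 2 <
      shiftScaleValue P R F (L 1) lam ρ₁ κ ((v + w) / 2 * A + m)
        (totalScale α B q ((v + w) / 2)) := by
  have hα0 : 0 < α := by linarith
  have hw : 0 ≤ w := hv.trans hvw.le
  have hmid := totalScale_midpoint_le hα.le hB.le hq v w
  have hmid0 := totalScale_nonneg (α := α) hB.le hq ((v + w) / 2)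
  have hlt : totalScale α B q v < totalScale α B q w :=
    totalScale_lt hα0 hB hq (by rwa [abs_of_nonneg hv, abs_of_nonneg hw])
  set s₁ := totalScale α B q v
  set s₂ := totalScale α B q w
  set s := totalScale α B q ((v + w) / 2)
  have em : (v * A + m + (w * A + m)) / 2 = (v + w) / 2 * A + m := by ring
  have h1 := integral_midpoint_lt hint hR_conc (hL.measure_gt_ne_zero hα)
    (m₁ := v * A + m) (m₂ := w * A + m) hlt.ne
  rw [em] at h1
  have h2 := integral_anti_scale hint hRm hR_conc.concaveOn (hL.symmetric 1)
    ((v + w) / 2 * A + m) hmid0 hmid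
  have hpen : F (s * ρ₁ - κ * ((v + w) / 2 * A + m)) ≤
      (F (s₁ * ρ₁ - κ * (v * A + m)) + F (s₂ * ρ₁ - κ * (w * A + m))) / 2 := by
    rcases le_or_gt 0 ρ₁ with h | h
    · have c : F ((1 / 2 : ℝ) • (s₁ * ρ₁ - κ * (v * A + m))
          + (1 / 2 : ℝ) • (s₂ * ρ₁ - κ * (w * A + m))) ≤ _ :=
        hF_conv.2 (mem_univ _) (mem_univ _) (by norm_num) (by norm_num) (by norm_num)
      simp only [smul_eq_mul] at c
      have hle := mul_le_mul_of_nonneg_right hmid h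
      refine (hF_mono ?_).trans (c.trans (le_of_eq (by ring)))
      linarith
    · have h3 : s * ρ₁ ≤ 0 := mul_nonpos_of_nonneg_of_nonpos hmid0 h.le
      have h4 : 0 ≤ κ * ((v + w) / 2 * A + m) := by positivity
      rw [penalty_eq_of_nonpos hF hF_mono hF_conv hF_zero (by linarith)]
      have h5 := penalty_zero_le hF hF_conv hF_zero (s₁ * ρ₁ - κ * (v * A + m))
      have h6 := penalty_zero_le hF hF_conv hF_zero (s₂ * ρ₁ - κ * (w * A + m))
      linarith
  have hpen' := mul_le_mul_of_nonneg_left hpen hlam.le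
  simp only [shiftScaleValue]
  linarith

end ShiftScaleValue

/-! ### Equilibrium controls -/

/-- If the control is constant in every period after time `n`, the value functional at `(n, x)`
depends on the control at time `n` only through the amount invested at `x`. -/
theorem valueFunctional_eq_shiftScaleValue {Ω : Type*} [MeasurableSpace Ω] {P : Measure Ω}
    [IsProbabilityMeasure P] {α : ℝ} (hα : 0 < α) {L : ℝ≥0 → Ω → ℝ}
    (hL : IsSymmetricStableLevy P α L) {r : ℝ} {μ σ : ℝ → ℝ} {N : ℕ}
    (hμ : ContinuousOn μ (Icc 0 N)) (hσ : ContinuousOn σ (Icc 0 N))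
    (hσ_pos : ∀ t ∈ Icc (0 : ℝ) N, 0 < σ t) {R F : ℝ → ℝ} (hR : Measurable R) (lam : ℝ → ℝ)
    {ρ : (Ω → ℝ) → EReal} (hρ : IsRiskMeasure P ρ) {κ ρ₁ : ℝ}
    (hκ : ∀ m s : ℝ, 0 ≤ s → ρ (fun ω => m + s * L 1 ω) = ((s * ρ₁ - κ * m : ℝ) : EReal))
    {X : ℕ → ℝ → (ℕ → ℝ → ℝ) → ℝ → Ω → ℝ} {n : ℕ} (hn : n < N) {x : ℝ} {u : ℕ → ℝ → ℝ}
    (hX : IsWealthProcess P L r μ σ N u n x (X n x u)) {c : ℕ → ℝ}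
    (hc : ∀ k, n < k → k < N → ∀ y, u k y = c k) :
    valueFunctional P r N R F lam ρ X n x u =
      ((shiftScaleValue P R F (L 1) (lam n) ρ₁ κ
        (u n x * excessReturn r μ N n + ∑ k ∈ Finset.Ico (n + 1) N, c k * excessReturn r μ N k)
        (totalScale α (noisePower α r σ N n)
          (∑ k ∈ Finset.Ico (n + 1) N, |c k| ^ α * noisePower α r σ N k) (u n x)) : ℝ) :
        EReal) := by
  have hne : ∀ k ∈ Finset.Ico (n + 1) N, k ≠ n := fun k hk => by
    have := (Finset.mem_Ico.1 hk).1
    omega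
  have hlaw := hX.identDistrib hα hL hμ hσ hσ_pos hn.le (c := Function.update c n (u n x)) (by
    intro k hk hkN
    rcases eq_or_lt_of_le hk with rfl | hk
    · filter_upwards [hX.start] with ω hω
      rw [hω, Function.update_self]
    · refine ae_of_all _ fun ω => ?_
      rw [hc k hk hkN, Function.update_of_ne hk.ne'])
  have hsum : ∀ f : ℝ → ℕ → ℝ, ∑ k ∈ Finset.Ico n N, f (Function.update c n (u n x) k) k
      = f (u n x) n + ∑ k ∈ Finset.Ico (n + 1) N, f (c k) k := fun f => by
    rw [Finset.sum_eq_sum_Ico_succ_bot hn, Function.update_self]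
    congr 1
    exact Finset.sum_congr rfl fun k hk => by rw [Function.update_of_ne (hne k hk)]
  rw [hsum fun v k => v * excessReturn r μ N k, hsum fun v k => |v| ^ α * noisePower α r σ N k]
    at hlaw
  have hq : 0 ≤ ∑ k ∈ Finset.Ico (n + 1) N, |c k| ^ α * noisePower α r σ N k :=
    Finset.sum_nonneg fun k hk => mul_nonneg (by positivity)
      (noisePower_pos (Finset.mem_Ico.1 hk).2 hσ hσ_pos).le
  have hs := totalScale_nonneg (α := α) (noisePower_pos (α := α) (r := r) hn hσ hσ_pos).le hq
    (u n x)
  have hE := (hlaw.comp hR).integral_eq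
  simp only [Function.comp_def] at hE
  rw [valueFunctional, hρ.law_inv _ _ hlaw, hE]
  have hρm := hκ (u n x * excessReturn r μ N n
    + ∑ k ∈ Finset.Ico (n + 1) N, c k * excessReturn r μ N k) _ hs
  rw [totalScale] at hρm
  rw [hρm, extendTop, if_neg (EReal.coe_ne_top _), EReal.toReal_coe, shiftScaleValue, totalScale,
    EReal.coe_sub, EReal.coe_mul]

/-- Every one-period deviation to a constant amount is no improvement on an equilibrium. -/
theorem IsNashEquilibrium.le {M : ℝ} {N : ℕ} {J : ℕ → ℝ → (ℕ → ℝ → ℝ) → EReal} {u : ℕ → ℝ → ℝ}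
    (h : IsNashEquilibrium M N J u) {n : ℕ} (hn : n < N) (x : ℝ) {v : ℝ} (hv : v ∈ Icc (-M) M) :
    J n x (Function.update u n fun _ => v) ≤ J n x u := by
  rw [← h.2 n hn x]
  exact le_iSup (fun v : Icc (-M) M => J n x (Function.update u n fun _ => (v : ℝ))) ⟨v, hv⟩

theorem IsControlLaw.update {M : ℝ} {u : ℕ → ℝ → ℝ} (hu : IsControlLaw M u) (n : ℕ) {v : ℝ}
    (hv : v ∈ Icc (-M) M) : IsControlLaw M (Function.update u n fun _ => v) := by
  intro k
  rcases eq_or_ne k n with rfl | hk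
  · rw [Function.update_self]
    exact ⟨measurable_const, fun _ => abs_le.2 hv⟩
  · rw [Function.update_of_ne hk]
    exact hu k

theorem StrictConcaveOn.not_affine {R : ℝ → ℝ} (hR : StrictConcaveOn ℝ univ R) :
    ¬ ∃ a b : ℝ, ∀ y, R y = a * y + b := by
  rintro ⟨a, b, h⟩
  have := hR.2 (mem_univ 0) (mem_univ 1) zero_ne_one (show (0 : ℝ) < 1 / 2 by norm_num)
    (show (0 : ℝ) < 1 / 2 by norm_num) (by norm_num)
  simp only [h, smul_eq_mul] at this
  linarith

theorem proposition4p6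
    {Ω : Type*} [MeasurableSpace Ω] (P : Measure Ω) [IsProbabilityMeasure P]
    -- the driving noise
    (α : ℝ) (hα : 1 < α ∧ α ≤ 2) (L : ℝ≥0 → Ω → ℝ) (hL : IsSymmetricStableLevy P α L)
    -- the market on `[0, N]` and the bound on the controls
    (N : ℕ) (r M : ℝ) (hM : 0 < M) (μ σ : ℝ → ℝ)
    (hμ : ContinuousOn μ (Icc 0 N)) (hσ : ContinuousOn σ (Icc 0 N))
    (hσ_pos : ∀ t ∈ Icc (0 : ℝ) N, 0 < σ t) (hμ_r : ∀ t ∈ Icc (0 : ℝ) N, r ≤ μ t)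
    -- the reward function
    (R : ℝ → ℝ) (hR : ContDiff ℝ 1 R) (hR_mono : Monotone R) (hR_conc : ConcaveOn ℝ univ R)
    (hR_int : ∀ (a b : ℝ) (t : ℝ≥0), 0 < t → t ≤ N → Integrable (fun ω => R (a + b * L t ω)) P)
    (hR'_int : ∀ (a b : ℝ) (t : ℝ≥0), 0 < t → t ≤ N →
      Integrable (fun ω => deriv R (a + b * L t ω)) P)
    -- the penalty function and the risk aversion
    (F : ℝ → ℝ) (hF : Differentiable ℝ F) (hF_mono : Monotone F) (hF_conv : ConvexOn ℝ univ F)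
    (hF_zero : deriv F 0 = 0)
    (lam : ℝ → ℝ) (hlam : ContinuousOn lam (Icc 0 N)) (hlam_pos : ∀ t ∈ Icc (0 : ℝ) N, 0 < lam t)
    -- the risk measure
    (ρ : (Ω → ℝ) → EReal) (hρ : IsRiskMeasure P ρ)
    (hρ_inv : CashInvariant P ρ ∨ ShiftInvariant P ρ) (hρ_fin : ρ (L 1) < ⊤)
    -- the wealth processes
    (X : ℕ → ℝ → (ℕ → ℝ → ℝ) → ℝ → Ω → ℝ)
    (hX : ∀ n < N, ∀ x u, IsControlLaw M u → IsWealthProcess P L r μ σ N u n x (X n x u)) :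
    -- optimal deterministic controls
    (∀ c : ℕ → ℝ,
      IsNashEquilibrium M N (valueFunctional P r N R F lam ρ X) (fun k _ => c k) →
      (∀ n < N, NonDegenerateAt P L r μ N R F ρ n) →
      ∀ n < N, 0 ≤ c n) ∧
    -- optimal feedback control laws, when the optimal control is unique
    (StrictConcaveOn ℝ univ R →
      ∀ u : ℕ → ℝ → ℝ,
        IsNashEquilibrium M N (valueFunctional P r N R F lam ρ X) u →
        ∀ n < N, ∀ y, 0 ≤ u n y) := by
  have hα0 : 0 < α := one_pos.trans hα.1
  have hRm : Measurable R := hR.continuous.measurable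
  obtain ⟨κ, hκ0, hκshift, hκ⟩ := hρ.exists_eq_affine hρ_inv (hL.measurable 1) hρ_fin
  set ρ₁ := (ρ (L 1)).toReal
  let A : ℕ → ℝ := excessReturn r μ N
  let B : ℕ → ℝ := noisePower α r σ N
  let m : (ℕ → ℝ) → ℕ → ℝ := fun c n => ∑ k ∈ Finset.Ico (n + 1) N, c k * A k
  let q : (ℕ → ℝ) → ℕ → ℝ := fun c n => ∑ k ∈ Finset.Ico (n + 1) N, |c k| ^ α * B k
  let G : (ℕ → ℝ) → ℕ → ℝ → ℝ := fun c n v =>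
    shiftScaleValue P R F (L 1) (lam n) ρ₁ κ (v * A n + m c n) (totalScale α (B n) (q c n) v)
  have hA : ∀ n < N, 0 ≤ A n := fun n hn => excessReturn_nonneg hn hμ_r
  have hB : ∀ n < N, 0 < B n := fun n hn => noisePower_pos hn hσ hσ_pos
  have hm : ∀ c n, (∀ k, n < k → k < N → 0 ≤ c k) → 0 ≤ m c n := fun c n hc =>
    Finset.sum_nonneg fun k hk => mul_nonneg (hc k (Finset.mem_Ico.1 hk).1 (Finset.mem_Ico.1 hk).2)
      (hA k (Finset.mem_Ico.1 hk).2)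
  have hq : ∀ c n, 0 ≤ q c n := fun c n => Finset.sum_nonneg fun k hk =>
    mul_nonneg (by positivity) (hB k (Finset.mem_Ico.1 hk).2).le
  have hlamn : ∀ n < N, 0 < lam n := fun n hn =>
    hlam_pos n ⟨n.cast_nonneg, by exact_mod_cast hn.le⟩
  have hint : ∀ n < N, ∀ a b : ℝ, Integrable (fun ω => R (a + b * L 1 ω)) P := fun n hn a b =>
    hR_int a b 1 one_pos (by exact_mod_cast Nat.one_le_of_lt hn)
  -- in an equilibrium with constant tail the amount invested at any wealth maximises `G`
  have hmax : ∀ u, IsNashEquilibrium M N (valueFunctional P r N R F lam ρ X) u → ∀ n < N,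
      ∀ c : ℕ → ℝ, (∀ k, n < k → k < N → ∀ y, u k y = c k) → ∀ x, ∀ v ∈ Icc (-M) M,
      G c n v ≤ G c n (u n x) := by
    intro u hu n hn c hc x v hv
    have h1 := hu.le hn x hv
    rw [valueFunctional_eq_shiftScaleValue hα0 hL hμ hσ hσ_pos hRm lam hρ hκ hn
        (hX n hn x _ (hu.1.update n hv)) (c := c)
        (fun k hk hkN y => by rw [Function.update_of_ne hk.ne']; exact hc k hk hkN y),
      valueFunctional_eq_shiftScaleValue hα0 hL hμ hσ hσ_pos hRm lam hρ hκ hn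
        (hX n hn x u hu.1) hc, EReal.coe_le_coe_iff, Function.update_self] at h1
    exact h1
  have h0M : (0 : ℝ) ∈ Icc (-M) M := ⟨by linarith, hM.le⟩
  -- a short position is not a maximiser if the tail is non-negative
  have hnonneg : ∀ u, IsNashEquilibrium M N (valueFunctional P r N R F lam ρ X) u → ∀ n < N,
      NonDegenerateAt P L r μ N R F ρ n → ∀ c : ℕ → ℝ,
      (∀ k, n < k → k < N → ∀ y, u k y = c k) → (∀ k, n < k → k < N → 0 ≤ c k) →
      ∀ x, 0 ≤ u n x := by
    intro u hu n hn hnd c hc hc0 x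
    by_contra hneg
    refine absurd (hmax u hu n hn c hc x 0 h0M) (not_le.2 ?_)
    refine shiftScaleValue_lt_of_neg hα.1 hL hRm hR_mono hR_conc (hint n hn) hF hF_mono hF_conv
      hF_zero (hlamn n hn) hκ0 (hA n hn) (hB n hn) (hq c n) (hm c n hc0) ?_ (not_le.1 hneg)
    refine hnd.imp_right (Or.imp (fun h => ⟨h.1, excessReturn_pos hn hμ hμ_r h.2⟩) ?_)
    rintro ⟨h1, h2, h3⟩
    refine ⟨EReal.toReal_pos h1 hρ_fin.ne, h2, h3.imp hκshift fun hμ0 => ?_⟩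
    have hA0 : ∀ k, n ≤ k → k < N → A k = 0 := fun k hk hkN => by
      have h4 : (n : ℝ) ≤ k := by exact_mod_cast hk
      have h5 : (k : ℝ) + 1 ≤ N := by exact_mod_cast hkN
      exact excessReturn_eq_zero fun s hs => hμ0 s ⟨h4.trans hs.1, hs.2.trans h5⟩
    refine ⟨hA0 n le_rfl hn, Finset.sum_eq_zero fun k hk => ?_⟩
    obtain ⟨h6, h7⟩ := Finset.mem_Ico.1 hk
    rw [hA0 k (by omega) h7, mul_zero]
  constructor
  · intro c hc hnd
    -- backward induction: `j` is the number of periods to go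
    have key : ∀ j n, N ≤ n + j → n < N → 0 ≤ c n := by
      intro j
      induction j with
      | zero => intro n h1 h2; omega
      | succ j ih =>
        intro n h1 h2
        exact hnonneg _ hc n h2 (hnd n h2) c (fun _ _ _ _ => rfl)
          (fun k hk hkN => ih k (by omega) hkN) 0
    exact fun n hn => key N n (by omega) hn
  · intro hstrict u hu
    have hnd : ∀ n, NonDegenerateAt P L r μ N R F ρ n := fun n => Or.inl hstrict.not_affine
    -- backward induction: strict concavity makes the maximiser of `G` unique, hence the
    -- equilibrium control does not depend on the wealth
    have key : ∀ j n, N ≤ n + j → n < N → (∀ x, 0 ≤ u n x) ∧ ∀ x, u n x = u n 0 := by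
      intro j
      induction j with
      | zero => intro n h1 h2; omega
      | succ j ih =>
        intro n h1 h2
        have hc : ∀ k, n < k → k < N → ∀ y, u k y = u k 0 := fun k hk hkN y =>
          (ih k (by omega) hkN).2 y
        have hc0 : ∀ k, n < k → k < N → 0 ≤ u k 0 := fun k hk hkN => (ih k (by omega) hkN).1 0
        have h0 := hnonneg u hu n h2 (hnd n) (fun k => u k 0) hc hc0
        refine ⟨h0, ?_⟩
        have hle : ∀ x y, u n x ≤ u n y := by
          intro x y
          by_contra! hlt
          have hmid := shiftScaleValue_midpoint_lt (ρ₁ := ρ₁) hα.1 hL hRm hstrict (hint n h2) hF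
            hF_mono hF_conv hF_zero (hlamn n h2) hκ0 (hA n h2) (hB n h2)
            (hq (fun k => u k 0) n) (hm (fun k => u k 0) n hc0) (h0 y) hlt
          have hb1 := abs_le.1 ((hu.1 n).2 x)
          have hb2 := abs_le.1 ((hu.1 n).2 y)
          have hmem : (u n y + u n x) / 2 ∈ Icc (-M) M := ⟨by linarith, by linarith⟩
          have e1 := hmax u hu n h2 (fun k => u k 0) hc x _ hmem
          have e2 := hmax u hu n h2 (fun k => u k 0) hc y _ hmem
          simp only [G] at e1 e2
          linarith
        exact fun x => le_antisymm (hle x 0) (hle 0 x)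
    exact fun n hn => (key N n (by omega) hn).1
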